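/- **Notation.** Let $\tau>0$. Let $G(z;\tau)$ be the Barnes double gamma function, that is, the entire function $$G(z;\tau)=\frac{1}{\tau\,\Gamma(z)}\exp\Big[\tilde a(\tau)\frac z\tau+\tilde b(\tau)\frac{z^2}{2\tau^2}\Big]\prod_{j=1}^\infty\frac{\Gamma(j\tau)}{\Gamma(z+j\tau)}\exp\Big[z\psi(j\tau)+\frac{z^2}{2}\psi'(j\tau)\Big],$$ where $\psi=\Gamma'/\Gamma$, $\tilde a(\tau)=\frac\tau2\log(2\pi\tau)+\frac12\log\tau-\tau C(\tau)$, $\tilde b(\tau)=-\tau\log\tau-\tau^2D(\tau)$, $$C(\tau)=\lim_{N\to\infty}\Big[\sum_{k=1}^{N-1}\psi(k\tau)+\tfrac12\psi(N\tau)-\tfrac1\tau\log\frac{\Gamma(N\tau)}{\sqrt{2\pi}}\Big],\qquad D(\tau)=\lim_{N\to\infty}\Big[\sum_{k=1}^{N-1}\psi'(k\tau)+\tfrac12\psi'(N\tau)-\tfrac1\tau\psi(N\tau)\Big].$$ Let $0\le m\le q$, $0\le n\le p$ be integers, $\varepsilon\in\mathbb C$, $a_i,b_i\in\mathbb C$ and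 $\alpha_i,\beta_i>0$. The Fox–Barnes $I$-function along a contour $\mathcal C$ is $$I^{m,n}_{p,q}\left[z;\tau,\varepsilon\,\middle|\,\begin{matrix}(a_i,\alpha_i)_{1,p}\\(b_i,\beta_i)_{1,q}\end{matrix}\right]=\frac1{2\pi i}\int_{\mathcal C}\frac{\prod_{i=1}^mG(b_i+\beta_is;\tau)\prod_{i=1}^nG(1+\tau-a_i-\alpha_is;\tau)}{\prod_{i=m+1}^qG(1+\tau-b_i-\beta_is;\tau)\prod_{i=n+1}^pG(a_i+\alpha_is;\tau)}\,e^{\pi\varepsilon s^2/\tau}z^{-s}\,ds .$$ Here $z$ is a point of the Riemann surface of the logarithm and $z^{-s}=e^{-s\log z}$. The curve $\mathcal C$ is piecewise continuously differentiable with both ends at infinity; it avoids, and separates from each other, the two families of points $s=(-b_i+j\tau+k)/\beta_i$ ($i=m+1,\dots,q$; $j,k\ge1$) and $s=-(a_i+j\tau+k)/\alpha_i$ ($i=n+1,\dots,p$; $j,k\ge0$). (For example, $\mathcal C$ may be a vertical line or a left or right loop.) **Proposition.** Let such parameters and such a contour $\mathcal C$ be given, let $\sigma\in\mathbb C$, and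 write $$I[z^\sigma]=I^{m,n}_{p,q}\left[z^\sigma;\tau,\varepsilon\,\middle|\,\begin{matrix}(a_i,\alpha_i)_{1,p}\\(b_i,\beta_i)_{1,q}\end{matrix}\right],\qquad \log(z^\sigma)=\sigma\log z .$$ In the following identities the $I$-functions on the right-hand side are integrals along the same contour $\mathcal C$. (i) If $n\ge1$: $$z\frac{d}{dz}I[z^\sigma]=\frac{\sigma}{\alpha_1}(a_1-1)\,I[z^\sigma]+\frac{\sigma\tau}{\alpha_1}\,I^{m,n+1}_{p+1,q+1}\left[z^\sigma;\tau,\varepsilon\,\middle|\,\begin{matrix}(a_1+\tau,\alpha_1),(a_1-1,\alpha_1),(a_i,\alpha_i)_{2,p}\\(b_i,\beta_i)_{1,q},(a_1+\tau-1,\alpha_1)\end{matrix}\right].$$ (i$'$) If $n\ge1$: $$z\frac{d}{dz}I[z^\sigma]=\frac{\sigma}{\alpha_1}(a_1-\tau)\,I[z^\sigma]+\frac{\sigma\tau}{\alpha_1}\,I^{m,n+1}_{p+1,q+1}\left[z^\sigma;\tau,\varepsilon\,\middle|\,\begin{matrix}(a_1+1,\alpha_1),(a_1-\tau,\alpha_1),(a_i,\alpha_i)_{2,p}\\(b_i,\beta_i)_{1,q},(a_1+1-\tau,\alpha_1)\end{matrix}\right].$$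 (ii) If $m\ge1$: $$z\frac{d}{dz}I[z^\sigma]=\frac{\sigma}{\beta_1}(b_1-1)\,I[z^\sigma]-\frac{\sigma\tau}{\beta_1}\,I^{m+1,n}_{p+1,q+1}\left[z^\sigma;\tau,\varepsilon\,\middle|\,\begin{matrix}(a_i,\alpha_i)_{1,p},(b_1+\tau-1,\beta_1)\\(b_1-1,\beta_1),(b_1+\tau,\beta_1),(b_i,\beta_i)_{2,q}\end{matrix}\right].$$ (ii$'$) If $m\ge1$: $$z\frac{d}{dz}I[z^\sigma]=\frac{\sigma}{\beta_1}(b_1-\tau)\,I[z^\sigma]-\frac{\sigma\tau}{\beta_1}\,I^{m+1,n}_{p+1,q+1}\left[z^\sigma;\tau,\varepsilon\,\middle|\,\begin{matrix}(a_i,\alpha_i)_{1,p},(b_1+1-\tau,\beta_1)\\(b_1-\tau,\beta_1),(b_1+1,\beta_1),(b_i,\beta_i)_{2,q}\end{matrix}\right].$$ (iii) If $q\ge m+1$: $$z\frac{d}{dz}I[z^\sigma]=\frac{\sigma}{\beta_q}b_q\,I[z^\sigma]+\frac{\sigma\tau}{\beta_q}\,I^{m,n+1}_{p+1,q+1}\left[z^\sigma;\tau,\varepsilon\,\middle|\,\begin{matrix}(1+\tau+b_q,\beta_q),(a_i,\alpha_i)_{1,p}\\(b_i,\beta_i)_{1,q-1},(b_q+\tau,\beta_q),(b_q+1,\beta_q)\end{matrix}\right].$$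 (iv) If $p\ge n+1$: $$z\frac{d}{dz}I[z^\sigma]=\frac{\sigma}{\alpha_p}(a_p-1-\tau)\,I[z^\sigma]-\frac{\sigma\tau}{\alpha_p}\,I^{m+1,n}_{p+1,q+1}\left[z^\sigma;\tau,\varepsilon\,\middle|\,\begin{matrix}(a_i,\alpha_i)_{1,p-1},(a_p-\tau,\alpha_p),(a_p-1,\alpha_p)\\(a_p-1-\tau,\alpha_p),(b_i,\beta_i)_{1,q}\end{matrix}\right].$$ Each identity holds in both of the following senses. * *Interior points.* Let $z\ne0$ and a holomorphic branch of $\log$ near $z$ be given, such that the integral that defines $I[w]$ converges absolutely for all $\log w$ in a neighbourhood of $\sigma\log z$. Then $I[z^\sigma]$ is complex differentiable at $z$, the integral for the $I$-function of order $(p+1,q+1)$ converges absolutely at $z^\sigma$, and the identity holds. * *Along a ray.* Let $\mathcal C$ lie in a vertical strip $|\operatorname{Re}s|\le M$, let $\sigma$ be real and $z=re^{i\varphi}$ with $r>0$, $\log z=\log r+i\varphi$, and suppose that the integrals for both $I$-functions in the identity converge absolutely at $z^\sigma$. Then $I[z^\sigma]$ is differentiable in $r$, and the identity holds with $z\,d/dz=r\,d/dr$.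 -/

import Mathlib

open Filter Topology MeasureTheory

noncomputable section

/-! ### The double gamma function `G(z; τ)` -/

/-- `C(τ) = lim_m (∑_{k=1}^{m-1} ψ(kτ) + ψ(mτ)/2 - τ⁻¹ log (Γ(mτ)/√(2π)))`,
where `ψ` is the digamma function. -/
def barnesC (τ : ℝ) : ℂ :=
  limUnder atTop fun m : ℕ =>
    ∑ k ∈ Finset.Ico 1 m, Complex.digamma (k * τ) + Complex.digamma (m * τ) / 2
      - ((1 / τ * Real.log (Real.Gamma (m * τ) / √(2 * Real.pi)) : ℝ) : ℂ)

/-- `D(τ) = lim_m (∑_{k=1}^{m-1} ψ'(kτ) + ψ'(mτ)/2 - τ⁻¹ ψ(mτ))`. -/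
def barnesD (τ : ℝ) : ℂ :=
  limUnder atTop fun m : ℕ =>
    ∑ k ∈ Finset.Ico 1 m, deriv Complex.digamma (k * τ) + deriv Complex.digamma (m * τ) / 2
      - 1 / τ * Complex.digamma (m * τ)

/-- `ã(τ) = (τ/2) log (2πτ) + (1/2) log τ - τ C(τ)`. -/
def barnesA (τ : ℝ) : ℂ :=
  ((τ / 2 * Real.log (2 * Real.pi * τ) + 1 / 2 * Real.log τ : ℝ) : ℂ) - τ * barnesC τ

/-- `b̃(τ) = - τ log τ - τ² D(τ)`. -/
def barnesB (τ : ℝ) : ℂ :=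
  ((-(τ * Real.log τ) : ℝ) : ℂ) - (τ : ℂ) ^ 2 * barnesD τ

/-- The Barnes double gamma function `G(z; τ)`, `τ > 0`. The zeros at `z = -jτ - k`, `j, k ≥ 0`,
come from `1 / Γ` in the formula: Mathlib's `Γ` has the value `0` at its poles, and `x / 0 = 0`. -/
def doubleGamma (τ : ℝ) (z : ℂ) : ℂ :=
  1 / (τ * Complex.Gamma z) * Complex.exp (barnesA τ * z / τ + barnesB τ * z ^ 2 / (2 * τ ^ 2)) *
    ∏' j : ℕ, (Complex.Gamma ((j + 1) * τ) / Complex.Gamma (z + (j + 1) * τ) *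
      Complex.exp (z * Complex.digamma ((j + 1) * τ)
        + z ^ 2 / 2 * deriv Complex.digamma ((j + 1) * τ)))

/-! ### The Fox-Barnes `I`-function -/

/-- The discrete data of `I^{m,n}_{p,q}`: the upper row `a = [(a₁,α₁), …, (a_p,α_p)]`, the lower
row `b = [(b₁,β₁), …, (b_q,β_q)]`, and `n ≤ p`, `m ≤ q`; here `p`, `q` are the lengths. -/
structure FoxBarnesData where
  m : ℕ
  n : ℕ
  a : List (ℂ × ℝ)
  b : List (ℂ × ℝ)

/-- The orders and the weights are admissible: `m ≤ q`, `n ≤ p`, and `αᵢ, βᵢ > 0`. -/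
structure FoxBarnesData.Admissible (P : FoxBarnesData) : Prop where
  m_le : P.m ≤ P.b.length
  n_le : P.n ≤ P.a.length
  α_pos : ∀ x ∈ P.a, 0 < x.2
  β_pos : ∀ x ∈ P.b, 0 < x.2

/-- The quotient of double gamma functions
`∏_{i≤m} G(bᵢ+βᵢs) ∏_{i≤n} G(1+τ-aᵢ-αᵢs) / (∏_{i>m} G(1+τ-bᵢ-βᵢs) ∏_{i>n} G(aᵢ+αᵢs))`. -/
def foxBarnesKernel (τ : ℝ) (P : FoxBarnesData) (s : ℂ) : ℂ :=
  (((P.b.take P.m).map fun x => doubleGamma τ (x.1 + x.2 * s)).prod *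
    ((P.a.take P.n).map fun x => doubleGamma τ (1 + τ - x.1 - x.2 * s)).prod) /
  (((P.b.drop P.m).map fun x => doubleGamma τ (1 + τ - x.1 - x.2 * s)).prod *
    ((P.a.drop P.n).map fun x => doubleGamma τ (x.1 + x.2 * s)).prod)

/-- The integrand, at the point `z = e^ζ` of the Riemann surface of the logarithm:
`z^{-s}` is `e^{-sζ}`. -/
def foxBarnesIntegrand (τ : ℝ) (ε : ℂ) (P : FoxBarnesData) (ζ s : ℂ) : ℂ :=
  foxBarnesKernel τ P s * Complex.exp (Real.pi * ε * s ^ 2 / τ) * Complex.exp (-s * ζ)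

/-- The integral that defines the `I`-function along the contour `γ` converges absolutely at the
point of the Riemann surface of the logarithm whose logarithm is `ζ`. -/
def FoxBarnesConverges (γ : ℝ → ℂ) (τ : ℝ) (ε : ℂ) (P : FoxBarnesData) (ζ : ℂ) : Prop :=
  Integrable fun t : ℝ => foxBarnesIntegrand τ ε P ζ (γ t) * deriv γ t

/-- The Fox-Barnes `I`-function `(1/2πi) ∫_γ 𝓘(s) e^{πεs²/τ} z^{-s} ds`, as a function of the
logarithm `ζ` of its argument `z`. -/
def foxBarnesI (γ : ℝ → ℂ) (τ : ℝ) (ε : ℂ) (P : FoxBarnesData) (ζ : ℂ) : ℂ :=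
  1 / (2 * Real.pi * Complex.I) * ∫ t : ℝ, foxBarnesIntegrand τ ε P ζ (γ t) * deriv γ t

/-- The poles `s = (-bᵢ + jτ + k)/βᵢ`, `j, k ≥ 1`, `i = m+1, …, q`. -/
def FoxBarnesData.rightPoles (τ : ℝ) (P : FoxBarnesData) : Set ℂ :=
  {s | ∃ x ∈ P.b.drop P.m, ∃ j k : ℕ, 1 ≤ j ∧ 1 ≤ k ∧ s = (-x.1 + j * τ + k) / x.2}

/-- The poles `s = -(aᵢ + jτ + k)/αᵢ`, `j, k ≥ 0`, `i = n+1, …, p`. -/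
def FoxBarnesData.leftPoles (τ : ℝ) (P : FoxBarnesData) : Set ℂ :=
  {s | ∃ x ∈ P.a.drop P.n, ∃ j k : ℕ, s = -(x.1 + j * τ + k) / x.2}

/-- `γ` is a contour for the `I`-function with data `P`: a piecewise continuously differentiable
curve that goes to infinity at both ends, avoids the poles, and separates the two families of poles
(no point of the one can be joined to a point of the other without crossing `γ`). Vertical lines,
left and right loops and contours that end in half-lines are of this kind. -/
structure IsFoxBarnesContour (γ : ℝ → ℂ) (τ : ℝ) (P : FoxBarnesData) : Prop where
  continuous : Continuous γ
  piecewise : ∃ S : Finset ℝ, ∀ t ∉ S, ContDiffAt ℝ 1 γ t ∧ deriv γ t ≠ 0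
  tendsto_top : Tendsto γ atTop (Bornology.cobounded ℂ)
  tendsto_bot : Tendsto γ atBot (Bornology.cobounded ℂ)
  avoids : ∀ t, γ t ∉ P.leftPoles τ ∧ γ t ∉ P.rightPoles τ
  separates : ∀ u ∈ P.leftPoles τ, ∀ v ∈ P.rightPoles τ, ¬ JoinedIn (Set.range γ)ᶜ u v

/-! ### The recurrence `z d/dz I_P[z^σ] = A I_P[z^σ] + B I_Q[z^σ]` -/

/-- The recurrence in the open domain of convergence, with the complex derivative. `L` is a branch
of the logarithm on an open set, so that `σ L(z)` is the logarithm of `z^σ`. It is part of the claim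
that `I_P[z^σ]` is differentiable and that the integral for `I_Q[z^σ]` converges. -/
def FoxBarnesRecurrence (γ : ℝ → ℂ) (τ : ℝ) (ε σ : ℂ) (P Q : FoxBarnesData) (A B : ℂ) : Prop :=
  ∀ (U : Set ℂ) (L : ℂ → ℂ), IsOpen U → ContinuousOn L U → (∀ w ∈ U, Complex.exp (L w) = w) →
    ∀ z ∈ U, (∀ᶠ ζ in 𝓝 (σ * L z), FoxBarnesConverges γ τ ε P ζ) →
      FoxBarnesConverges γ τ ε Q (σ * L z) ∧
      DifferentiableAt ℂ (fun w => foxBarnesI γ τ ε P (σ * L w)) z ∧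
      z * deriv (fun w => foxBarnesI γ τ ε P (σ * L w)) z =
        A * foxBarnesI γ τ ε P (σ * L z) + B * foxBarnesI γ τ ε Q (σ * L z)

/-- The recurrence along a ray `z = r e^{iφ}`, `r > 0`, with `σ` real, at the points where both
integrals converge; `z d/dz = r d/dr` on the ray. -/
def FoxBarnesRayRecurrence (γ : ℝ → ℂ) (τ : ℝ) (ε σ : ℂ) (P Q : FoxBarnesData) (A B : ℂ) : Prop :=
  σ.im = 0 → ∀ r φ : ℝ, 0 < r →
    FoxBarnesConverges γ τ ε P (σ * (Real.log r + φ * Complex.I)) →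
    FoxBarnesConverges γ τ ε Q (σ * (Real.log r + φ * Complex.I)) →
      DifferentiableAt ℝ
        (fun x : ℝ => foxBarnesI γ τ ε P (σ * (Real.log x + φ * Complex.I))) r ∧
      r * deriv (fun x : ℝ => foxBarnesI γ τ ε P (σ * (Real.log x + φ * Complex.I))) r =
        A * foxBarnesI γ τ ε P (σ * (Real.log r + φ * Complex.I)) +
        B * foxBarnesI γ τ ε Q (σ * (Real.log r + φ * Complex.I))

/-- Both forms of the recurrence; the one along rays is for contours in a vertical strip, where the
domain of convergence may be a single ray. -/
def FoxBarnesEuler (γ : ℝ → ℂ) (τ : ℝ) (ε σ : ℂ) (P Q : FoxBarnesData) (A B : ℂ) : Prop :=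
  FoxBarnesRecurrence γ τ ε σ P Q A B ∧
  ((∃ M : ℝ, ∀ t, |(γ t).re| ≤ M) → FoxBarnesRayRecurrence γ τ ε σ P Q A B)

end

/-! All six identities come from one relation for the double gamma function, `G(v) G(v+1+τ) = (v/τ)
G(v+1) G(v+τ)`. For a suitable affine function `v = c + d s`, the parameter that is singled out
contributes to the kernel of `P` a factor `G(v+1)` or `G(v+τ)` in the numerator, or `G(v+1+τ)` in
the denominator. Passing to `Q` then multiplies the kernel by `v/τ`. Since `z d/dz` brings down `-σ
s`, which is an affine combination of `1` and `v/τ`, the recurrence is differentiation under the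
integral sign (`foxBarnesEuler_of_kernel_eq`).

The relation (`doubleGamma_mul_doubleGamma_add`) is proved without the separate functional equations
for the shifts by `1` and `τ`. In this mixed second difference of `log G` the linear exponent `ã`,
and with it `C(τ)`, cancels. The product over `j` telescopes by `Γ(w+1) = w Γ(w)`, and what remains
is exactly the limit that defines `D(τ)`. This needs convergence of the product, `ψ'(x) → 0` and
`e^{ψ(x)} ~ x`. All three follow from one explicit estimate of `Γ(x)/Γ(x+z)` through Euler's
product, which also identifies `ψ(x)` and `ψ'(x)`. -/

/-! ### Canonical product for `Γ(x)/Γ(x+z)` and the values of `ψ`, `ψ'` -/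

/-- The Weierstrass elementary factor `(1 + u) exp (-u + u² / 2)` is `1 + O(u³)`. -/
lemma norm_elementaryFactor_sub_one_le {u : ℂ} (hu : ‖u‖ ≤ 1) :
    ‖(1 + u) * Complex.exp (-u + u ^ 2 / 2) - 1‖ ≤ 100 * ‖u‖ ^ 3 := by
  set w : ℂ := -u + u ^ 2 / 2 with hw
  have hwn : ‖w‖ ≤ 3 / 2 * ‖u‖ := by
    calc ‖w‖ ≤ ‖-u‖ + ‖u ^ 2 / 2‖ := norm_add_le _ _
      _ = ‖u‖ + ‖u‖ ^ 2 / 2 := by simp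
      _ ≤ _ := by nlinarith [norm_nonneg u]
  have hR := Complex.norm_exp_sub_sum_le_norm_mul_exp w 3
  have he : Real.exp ‖w‖ ≤ 9 := by
    calc Real.exp ‖w‖ ≤ Real.exp (1 + 1) := Real.exp_le_exp.2 (by linarith)
      _ = Real.exp 1 * Real.exp 1 := Real.exp_add _ _
      _ ≤ 9 := by nlinarith [Real.exp_one_lt_d9, Real.exp_pos 1]
  set R : ℂ := Complex.exp w - ∑ m ∈ Finset.range 3, w ^ m / (m.factorial : ℂ) with hRdef
  have hR' : ‖R‖ ≤ 27 / 8 * 9 * ‖u‖ ^ 3 := by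
    calc ‖R‖ ≤ ‖w‖ ^ 3 * Real.exp ‖w‖ := hR
      _ ≤ (3 / 2 * ‖u‖) ^ 3 * 9 := by gcongr
      _ = _ := by ring
  have hexp : Complex.exp w = 1 + w + w ^ 2 / 2 + R := by
    rw [hRdef]; simp [Finset.sum_range_succ]
  have key : (1 + u) * Complex.exp w - 1
      = u ^ 3 * (1 / 2 - 3 / 8 * u + u ^ 2 / 8) + (1 + u) * R := by
    rw [hexp, hw]; ring
  rw [key]
  have h1 : ‖(1 / 2 - 3 / 8 * u + u ^ 2 / 8 : ℂ)‖ ≤ 1 := by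
    calc ‖(1 / 2 - 3 / 8 * u + u ^ 2 / 8 : ℂ)‖
        ≤ ‖(1 / 2 : ℂ)‖ + ‖3 / 8 * u‖ + ‖u ^ 2 / 8‖ :=
          (norm_add_le _ _).trans (by gcongr; exact norm_sub_le _ _)
      _ = 1 / 2 + 3 / 8 * ‖u‖ + ‖u‖ ^ 2 / 8 := by simp
      _ ≤ 1 := by nlinarith [norm_nonneg u]
  have h2 : ‖1 + u‖ ≤ 2 := (norm_add_le _ _).trans (by simp; linarith)
  calc _ ≤ ‖u ^ 3 * (1 / 2 - 3 / 8 * u + u ^ 2 / 8)‖ + ‖(1 + u) * R‖ := norm_add_le _ _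
    _ ≤ ‖u‖ ^ 3 * 1 + 2 * (27 / 8 * 9 * ‖u‖ ^ 3) := by
      rw [norm_mul, norm_mul, norm_pow]; gcongr
    _ ≤ _ := by nlinarith [pow_nonneg (norm_nonneg u) 3]

lemma sum_range_inv_add_sq_le {x : ℝ} (hx : 0 < x) (n : ℕ) :
    ∑ k ∈ Finset.range n, 1 / (x + k) ^ 2 ≤ (1 + x) / x ^ 2 := by
  -- The subtracted `1/(x+n)` makes the induction telescope; since `(1+x)/x² = 1/x² + 1/x`, the case
  -- of one term is an equality.
  have h : ∀ n : ℕ, ∑ k ∈ Finset.range (n + 1), 1 / (x + k) ^ 2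
      ≤ (1 + x) / x ^ 2 - 1 / (x + n) := by
    intro n
    induction n with
    | zero => simp only [zero_add, Finset.sum_range_one, Nat.cast_zero, add_zero]
              apply le_of_eq; field_simp; ring
    | succ n ih =>
      rw [Finset.sum_range_succ]
      have hy : 0 < x + n := by positivity
      have : 1 / (x + (n + 1 : ℕ)) ^ 2 ≤ 1 / (x + n) - 1 / (x + (n + 1 : ℕ)) := by
        push_cast
        rw [← add_assoc, div_sub_div _ _ (by positivity) (by positivity),
          div_le_div_iff₀ (by positivity) (by positivity)]
        nlinarith [sq_nonneg (x + n), mul_pos hy hy]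
      linarith
  rcases n with _ | n
  · simp; positivity
  · exact (h n).trans (sub_le_self _ (by positivity))

lemma sum_range_inv_add_cube_le {x : ℝ} (hx : 0 < x) (n : ℕ) :
    ∑ k ∈ Finset.range n, 1 / (x + k) ^ 3 ≤ (1 + x) / x ^ 3 := by
  calc ∑ k ∈ Finset.range n, 1 / (x + k) ^ 3
      ≤ ∑ k ∈ Finset.range n, 1 / x * (1 / (x + k) ^ 2) := by
        gcongr with k
        rw [div_mul_div_comm, one_mul, pow_succ' _ 2]
        gcongr
        simp
    _ = 1 / x * ∑ k ∈ Finset.range n, 1 / (x + k) ^ 2 := by rw [Finset.mul_sum]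
    _ ≤ 1 / x * ((1 + x) / x ^ 2) := by gcongr; exact sum_range_inv_add_sq_le hx n
    _ = _ := by field_simp

lemma summable_inv_add_sq {x : ℝ} (hx : 0 < x) : Summable fun k : ℕ => 1 / (x + k) ^ 2 :=
  summable_of_sum_range_le (fun _ => by positivity) (sum_range_inv_add_sq_le hx)

/-- Comparison with the harmonic numbers, the differences being `O(1/k²)`. The limit is `-ψ(x)`,
which is recognised only in `hasDerivAt_digamma_of_Gamma_div_Gamma`. -/
lemma exists_tendsto_sum_inv_add_sub_log {x : ℝ} (hx : 0 < x) :
    ∃ a : ℝ, Tendsto (fun n : ℕ => ∑ k ∈ Finset.range (n + 1), 1 / (x + k) - Real.log n)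
      atTop (𝓝 a) := by
  have hs : Summable fun k : ℕ => 1 / (x + k) - 1 / (1 + k : ℝ) := by
    refine Summable.of_norm_bounded
      (((summable_inv_add_sq hx).add (summable_inv_add_sq one_pos)).mul_left |1 - x|) fun k => ?_
    have h1 : 0 < x + k := by positivity
    have h2 : 0 < 1 + (k : ℝ) := by positivity
    have : 1 / (x + k) - 1 / (1 + k : ℝ) = (1 - x) * (1 / (x + k) * (1 / (1 + k))) := by
      field_simp; ring
    rw [this, norm_mul, Real.norm_eq_abs]
    gcongr
    rw [Real.norm_of_nonneg (by positivity), ← one_div_pow, ← one_div_pow]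
    nlinarith [sq_nonneg (1 / (x + k) - 1 / (1 + k : ℝ)), sq_nonneg (1 / (x + k)),
      sq_nonneg (1 / (1 + k : ℝ))]
  have h1 := (hs.hasSum.tendsto_sum_nat.comp (tendsto_add_atTop_nat 1)).add
    (Real.tendsto_harmonic_sub_log.add tendsto_one_div_add_atTop_nhds_zero_nat)
  refine ⟨_, h1.congr fun n => ?_⟩
  simp only [Function.comp, Finset.sum_sub_distrib]
  have : (harmonic n : ℝ) = ∑ k ∈ Finset.range n, 1 / (1 + k : ℝ) := by
    simp [harmonic, add_comm]
  rw [this, Finset.sum_range_succ (fun k : ℕ => 1 / (1 + k : ℝ))]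
  ring

/-- In the quotient of Euler's approximations `n!` cancels, the powers of `n` leave `n^{-z}`, and
the rest is a finite product. -/
lemma GammaSeq_div_GammaSeq {x : ℝ} (hx : 0 < x) {z : ℂ} {n : ℕ} (hn : n ≠ 0) :
    Complex.GammaSeq x n / Complex.GammaSeq (x + z) n =
      Complex.exp (-z * Real.log n) * ∏ k ∈ Finset.range (n + 1), (1 + z / (x + k)) := by
  have hn' : (n : ℂ) ≠ 0 := by exact_mod_cast hn
  have hp : ∏ k ∈ Finset.range (n + 1), (1 + z / ((x : ℂ) + k))
      = (∏ k ∈ Finset.range (n + 1), ((x : ℂ) + z + k)) /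
        ∏ k ∈ Finset.range (n + 1), ((x : ℂ) + k) := by
    rw [← Finset.prod_div_distrib]
    refine Finset.prod_congr rfl fun k _ => ?_
    have : (x : ℂ) + k ≠ 0 := by
      have : x + k ≠ 0 := by positivity
      exact_mod_cast this
    field_simp; ring
  have he : Complex.exp (-z * Real.log n) = (n : ℂ) ^ (x : ℂ) / (n : ℂ) ^ ((x : ℂ) + z) := by
    rw [← Complex.cpow_sub _ _ hn', Complex.cpow_def_of_ne_zero hn', Complex.natCast_log]
    ring_nf
  rw [hp, he, Complex.GammaSeq, Complex.GammaSeq]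
  have hf : ((n.factorial : ℕ) : ℂ) ≠ 0 := by exact_mod_cast n.factorial_ne_zero
  rw [div_div_div_eq, div_mul_div_comm, ← mul_div_mul_right ((n : ℂ) ^ (x : ℂ) * _) _ hf]
  congr 1 <;> ring

/-- For `x > 0` the quotient `Γ(x) / Γ(x + z)` is a Gaussian factor times a canonical product of
elementary factors, and the product is `1 + O(z³)`, uniformly for large `x`. -/
lemma exists_norm_Gamma_div_Gamma_mul_exp_sub_one_le {x : ℝ} (hx : 0 < x) :
    ∃ a b : ℝ, 0 ≤ b ∧ b ≤ (1 + x) / x ^ 2 ∧ ∀ z : ℂ, ‖z‖ < x →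
      ‖Complex.Gamma x / Complex.Gamma (x + z) * Complex.exp (-z * a + z ^ 2 / 2 * b) - 1‖
        ≤ Real.exp (100 * ‖z‖ ^ 3 * ((1 + x) / x ^ 3)) - 1 := by
  obtain ⟨a, ha⟩ := exists_tendsto_sum_inv_add_sub_log hx
  have hb := (summable_inv_add_sq hx).hasSum.tendsto_sum_nat.comp (tendsto_add_atTop_nat 1)
  refine ⟨a, ∑' k : ℕ, 1 / (x + k) ^ 2, tsum_nonneg fun _ => by positivity,
    Real.tsum_le_of_sum_range_le (fun _ => by positivity) (sum_range_inv_add_sq_le hx),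
    fun z hz => ?_⟩
  set b := ∑' k : ℕ, 1 / (x + k) ^ 2
  have hre : 0 < ((x : ℂ) + z).re := by
    have := (Complex.abs_re_le_norm z).trans_lt hz
    rw [abs_lt] at this
    simp; linarith
  have hG := Complex.Gamma_ne_zero_of_re_pos hre
  have hlim := ((Complex.GammaSeq_tendsto_Gamma x).div
    (Complex.GammaSeq_tendsto_Gamma (x + z)) hG).mul
    ((Complex.continuous_exp.tendsto _).comp
      ((((Complex.continuous_ofReal.tendsto _).comp ha).const_mul (-z)).add
        (((Complex.continuous_ofReal.tendsto _).comp hb).const_mul (z ^ 2 / 2))))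
  refine le_of_tendsto ((hlim.sub_const 1).norm) ?_
  filter_upwards [eventually_ne_atTop 0] with n hn
  simp only [Pi.div_apply, Function.comp]
  rw [GammaSeq_div_GammaSeq hx hn]
  -- The terms in `log n` cancel, and the partial sums of `1/(x+k)` and `1/(x+k)²` distribute over
  -- the product as the exponents of the elementary factors.
  have hprod : Complex.exp (-z * Real.log n) *
      (∏ k ∈ Finset.range (n + 1), (1 + z / ((x : ℂ) + k))) *
        Complex.exp (-z * ((∑ k ∈ Finset.range (n + 1), 1 / (x + k) - Real.log n : ℝ) : ℂ) +
          z ^ 2 / 2 * ((∑ k ∈ Finset.range (n + 1), 1 / (x + k) ^ 2 : ℝ) : ℂ))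
      = ∏ k ∈ Finset.range (n + 1), (1 + ((1 + z / ((x : ℂ) + k)) *
          Complex.exp (-(z / ((x : ℂ) + k)) + (z / ((x : ℂ) + k)) ^ 2 / 2) - 1)) := by
    simp only [add_sub_cancel, Finset.prod_mul_distrib, ← Complex.exp_sum]
    rw [mul_right_comm, ← Complex.exp_add, mul_comm]
    congr 2
    push_cast
    rw [Finset.sum_add_distrib, Finset.sum_neg_distrib, ← Finset.sum_div]
    simp only [div_eq_mul_one_div z, mul_pow, one_div_pow]
    rw [← Finset.mul_sum, ← Finset.mul_sum]
    ring
  rw [hprod]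
  refine (Finset.norm_prod_one_add_sub_one_le _ _).trans ?_
  gcongr
  calc _ ≤ ∑ k ∈ Finset.range (n + 1), 100 * ‖z‖ ^ 3 * (1 / (x + k) ^ 3) := by
        gcongr with k
        have hk : ‖z / ((x : ℂ) + k)‖ = ‖z‖ / (x + k) := by
          rw [norm_div]
          congr 1
          rw [← Complex.ofReal_natCast, ← Complex.ofReal_add, Complex.norm_real,
            Real.norm_of_nonneg (by positivity)]
        have hk1 : ‖z / ((x : ℂ) + k)‖ ≤ 1 := by
          rw [hk, div_le_one (by positivity)]
          have : (0 : ℝ) ≤ k := by positivity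
          linarith
        refine (norm_elementaryFactor_sub_one_le hk1).trans (le_of_eq ?_)
        rw [hk, div_pow]; ring
    _ ≤ _ := by
        rw [← Finset.mul_sum]
        gcongr
        exact sum_range_inv_add_cube_le hx _

/-- A holomorphic function that is `1 + O(z³)` at `0` has logarithmic derivative `O(z²)`. -/
lemma logDeriv_isBigO_sq {f : ℂ → ℂ} (hf : ∀ᶠ z in 𝓝 0, DifferentiableAt ℂ f z)
    (h : (fun z => f z - 1) =O[𝓝 0] fun z => z ^ 3) :
    logDeriv f =O[𝓝 0] fun z => z ^ 2 := by
  have hd : deriv f =O[𝓝 0] fun z => z ^ 2 := by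
    obtain ⟨C, hC⟩ := h.bound
    obtain ⟨r, hr, hball⟩ := Metric.eventually_nhds_iff_ball.1 (hf.and hC)
    have h0 : HasDerivAt f 0 0 := by
      have h1 : HasFDerivAt (fun z => f z - 1) (0 : ℂ →L[ℂ] ℂ) 0 :=
        Asymptotics.IsBigO.hasFDerivAt (n := 3) (by simpa using h.norm_right) (by norm_num)
      simpa using h1.hasDerivAt.add_const (1 : ℂ)
    -- Cauchy's estimate on the circle of radius `‖z‖` about `z`: there `‖w‖ ≤ 2‖z‖`, so `f - 1` is
    -- at most `8C‖z‖³`, and division by the radius leaves `‖z‖²`.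
    refine Asymptotics.IsBigO.of_bound (C * 8) ?_
    filter_upwards [Metric.ball_mem_nhds (0 : ℂ) (half_pos hr)] with z hz
    rw [mem_ball_zero_iff] at hz
    rcases eq_or_ne z 0 with rfl | hz0
    · simp [h0.deriv]
    have hz0' : 0 < ‖z‖ := norm_pos_iff.2 hz0
    have hC0 : 0 ≤ C := by
      have := (norm_nonneg _).trans (hball z (by rw [mem_ball_zero_iff]; linarith)).2
      exact nonneg_of_mul_nonneg_left this (by rw [norm_pow]; positivity)
    have hw : ∀ w ∈ Metric.closedBall z ‖z‖, ‖w‖ ≤ 2 * ‖z‖ := fun w hw => by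
      have : ‖w - z‖ ≤ ‖z‖ := by simpa [dist_eq_norm] using hw
      calc ‖w‖ = ‖w - z + z‖ := by simp
        _ ≤ _ := norm_add_le _ _
        _ ≤ _ := by linarith
    have hD : DiffContOnCl ℂ (fun w => f w - 1) (Metric.ball z ‖z‖) := by
      refine DifferentiableOn.diffContOnCl fun w hw' => ?_
      have := hw w (Metric.closure_ball_subset_closedBall hw')
      exact ((hball w (by rw [mem_ball_zero_iff]; linarith)).1.sub_const 1).differentiableWithinAt
    have hb := Complex.norm_deriv_le_of_forall_mem_sphere_norm_le hz0' hD
      (C := C * 8 * ‖z‖ ^ 3) fun w hw' => by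
        have h2 := hw w (Metric.sphere_subset_closedBall hw')
        refine (hball w (by rw [mem_ball_zero_iff]; linarith)).2.trans ?_
        rw [norm_pow, mul_assoc]
        gcongr
        calc ‖w‖ ^ 3 ≤ (2 * ‖z‖) ^ 3 := by gcongr
          _ = _ := by ring
    rw [deriv_sub_const] at hb
    refine hb.trans (le_of_eq ?_)
    rw [norm_pow]; field_simp
  have h1 : Tendsto f (𝓝 0) (𝓝 1) := by
    have : Tendsto (fun z => f z - 1) (𝓝 0) (𝓝 0) :=
      h.trans_tendsto (by simpa using (continuous_pow 3).tendsto (0 : ℂ))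
    simpa using this.add_const 1
  have h2 : (fun z => (f z)⁻¹) =O[𝓝 0] fun _ => (1 : ℂ) :=
    (h1.inv₀ one_ne_zero).isBigO_one ℂ
  have h3 := hd.mul h2
  simp only [mul_one] at h3
  exact h3

lemma Gamma_div_Gamma_exp_isBigO {x a b : ℝ} (hx : 0 < x)
    (h : ∀ z : ℂ, ‖z‖ < x →
      ‖Complex.Gamma x / Complex.Gamma (x + z) * Complex.exp (-z * a + z ^ 2 / 2 * b) - 1‖
        ≤ Real.exp (100 * ‖z‖ ^ 3 * ((1 + x) / x ^ 3)) - 1) :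
    (fun z : ℂ => Complex.Gamma x / Complex.Gamma (x + z) *
      Complex.exp (-z * a + z ^ 2 / 2 * b) - 1) =O[𝓝 0] fun z => z ^ 3 := by
  set K := 100 * ((1 + x) / x ^ 3) with hK
  refine Asymptotics.IsBigO.of_bound (K * Real.exp (K * x ^ 3)) ?_
  filter_upwards [Metric.ball_mem_nhds (0 : ℂ) hx] with z hz
  rw [mem_ball_zero_iff] at hz
  refine (h z hz).trans ?_
  have h1 : Real.exp (K * ‖z‖ ^ 3) - 1 ≤ K * ‖z‖ ^ 3 * Real.exp (K * ‖z‖ ^ 3) := by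
    have := Real.add_one_le_exp (-(K * ‖z‖ ^ 3))
    have h2 := mul_le_mul_of_nonneg_right this (Real.exp_pos (K * ‖z‖ ^ 3)).le
    rw [← Real.exp_add, neg_add_cancel, Real.exp_zero] at h2
    linarith
  calc Real.exp (100 * ‖z‖ ^ 3 * ((1 + x) / x ^ 3)) - 1
      = Real.exp (K * ‖z‖ ^ 3) - 1 := by rw [hK]; ring_nf
    _ ≤ K * ‖z‖ ^ 3 * Real.exp (K * x ^ 3) := h1.trans (by gcongr)
    _ = _ := by rw [norm_pow]; ring

/-- The logarithmic derivative of the quotient is `-ψ(x+z) - a + z b`. Because the quotient is `1 +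
O(z³)`, this is `O(z²)`, which is the first-order Taylor expansion of `ψ` at `x`. -/
lemma hasDerivAt_digamma_of_Gamma_div_Gamma {x a b : ℝ} (hx : 0 < x)
    (h : (fun z : ℂ => Complex.Gamma x / Complex.Gamma (x + z) *
      Complex.exp (-z * a + z ^ 2 / 2 * b) - 1) =O[𝓝 0] fun z => z ^ 3) :
    Complex.digamma x = -a ∧ HasDerivAt Complex.digamma b x := by
  have hre : ∀ᶠ z : ℂ in 𝓝 0, 0 < ((x : ℂ) + z).re := by
    refine (continuous_const.add Complex.continuous_re).continuousAt.eventually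
      (lt_mem_nhds ?_)
    simpa using hx
  have hd : ∀ z : ℂ, 0 < ((x : ℂ) + z).re → HasDerivAt (fun z : ℂ => Complex.Gamma x /
      Complex.Gamma (x + z) * Complex.exp (-z * a + z ^ 2 / 2 * b))
      ((Complex.Gamma x / Complex.Gamma (x + z) * Complex.exp (-z * a + z ^ 2 / 2 * b)) *
        (-Complex.digamma (x + z) - a + z * b)) z := fun z hz => by
    have hG := Complex.Gamma_ne_zero_of_re_pos hz
    have hdG : HasDerivAt (fun z : ℂ => Complex.Gamma (x + z))
        (deriv Complex.Gamma (x + z)) z := by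
      refine HasDerivAt.comp_const_add _ _ (Complex.differentiableAt_Gamma _ fun m hm => ?_).hasDerivAt
      rw [hm] at hz
      simp only [Complex.neg_re, Complex.natCast_re] at hz
      have : (0 : ℝ) ≤ m := by positivity
      linarith
    have he : HasDerivAt (fun z : ℂ => -z * a + z ^ 2 / 2 * b) (-a + z * b) z := by
      have := ((hasDerivAt_id z).neg.mul_const (a : ℂ)).add
        (((hasDerivAt_pow 2 z).div_const 2).mul_const (b : ℂ))
      refine (this.congr_deriv ?_)
      simp
    refine (((hasDerivAt_const z _).div hdG hG).mul he.cexp).congr_deriv ?_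
    rw [Complex.digamma_def, logDeriv_apply, Pi.div_apply]
    field_simp; ring
  have hO := logDeriv_isBigO_sq (hre.mono fun z hz => (hd z hz).differentiableAt) h
  have hO' : (fun z : ℂ => Complex.digamma (x + z) + a - z * b) =O[𝓝 0] fun z => z ^ 2 := by
    refine hO.neg_left.congr' (hre.mono fun z hz => ?_) EventuallyEq.rfl
    have hne : Complex.Gamma x / Complex.Gamma (x + z) *
        Complex.exp (-z * a + z ^ 2 / 2 * b) ≠ 0 :=
      mul_ne_zero (div_ne_zero (Complex.Gamma_ne_zero_of_re_pos (by simpa using hx))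
        (Complex.Gamma_ne_zero_of_re_pos hz)) (Complex.exp_ne_zero _)
    simp only [logDeriv_apply]
    rw [(hd z hz).deriv, mul_div_cancel_left₀ _ hne]
    ring
  refine ⟨?_, ?_⟩
  · have := Asymptotics.IsBigO.eq_zero_of_norm_pow (n := 2) (x₀ := (0 : ℂ)) (by simpa using hO'.norm_right)
      two_ne_zero
    simpa [add_eq_zero_iff_eq_neg] using this
  · have h1 : HasFDerivAt (fun z : ℂ => Complex.digamma (x + z) + a - z * b) (0 : ℂ →L[ℂ] ℂ) 0 :=
      Asymptotics.IsBigO.hasFDerivAt (n := 2) (by simpa using hO'.norm_right) (by norm_num)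
    have h2 := (h1.hasDerivAt.add ((hasDerivAt_id (0 : ℂ)).mul_const (b : ℂ))).sub_const (a : ℂ)
    have h3 : HasDerivAt (fun z : ℂ => Complex.digamma (x + z)) b 0 := by
      simpa using h2
    have h4 : HasDerivAt (fun z : ℂ => Complex.digamma (x + (-x + z))) b x :=
      HasDerivAt.comp_const_add (f := fun z : ℂ => Complex.digamma (x + z)) (-(x : ℂ)) (x : ℂ)
        (by simpa using h3)
    simpa using h4

/-! ### The factors of the double gamma function and convergence of their product -/

/-- The factor `Γ(x) / Γ(x + z) exp (z ψ(x) + z² / 2 ψ'(x))` of the double gamma function. -/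
noncomputable def barnesFactor (x : ℝ) (z : ℂ) : ℂ :=
  Complex.Gamma x / Complex.Gamma (x + z) *
    Complex.exp (z * Complex.digamma x + z ^ 2 / 2 * deriv Complex.digamma x)

/-- Besides the estimates, real `a` and `b` record that `ψ` and `ψ'` are real on the positive axis;
`exp_mul_barnesD` needs this to recover a limit from its exponential. -/
lemma exists_digamma_eq {x : ℝ} (hx : 0 < x) :
    ∃ a b : ℝ, Complex.digamma x = a ∧ deriv Complex.digamma x = b ∧
      0 ≤ b ∧ b ≤ (1 + x) / x ^ 2 ∧ ∀ z : ℂ, ‖z‖ < x →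
      ‖barnesFactor x z - 1‖ ≤ Real.exp (100 * ‖z‖ ^ 3 * ((1 + x) / x ^ 3)) - 1 := by
  obtain ⟨a, b, h0, hb, h⟩ := exists_norm_Gamma_div_Gamma_mul_exp_sub_one_le hx
  obtain ⟨h1, h2⟩ := hasDerivAt_digamma_of_Gamma_div_Gamma hx (Gamma_div_Gamma_exp_isBigO hx h)
  refine ⟨-a, b, by simpa using h1, h2.deriv, h0, hb, fun z hz => ?_⟩
  have := h z hz
  rw [barnesFactor, h1, h2.deriv]
  simpa using this

lemma barnesFactor_eq_zero_iff {x : ℝ} (hx : 0 < x) {z : ℂ} :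
    barnesFactor x z = 0 ↔ Complex.Gamma (x + z) = 0 := by
  have : Complex.Gamma x ≠ 0 := Complex.Gamma_ne_zero_of_re_pos (by simpa using hx)
  simp [barnesFactor, this]

/-- At `x = (j+1)τ` the exponent in the estimate is `O(j⁻²)`. The estimate requires `‖z‖ < x`, so it
is used for large `j` only. -/
lemma summable_norm_barnesFactor_sub_one {τ : ℝ} (hτ : 0 < τ) (z : ℂ) :
    Summable fun j : ℕ => ‖barnesFactor ((j + 1) * τ) z - 1‖ := by
  set t : ℕ → ℝ := fun j => 100 * ‖z‖ ^ 3 * ((1 + (j + 1) * τ) / ((j + 1) * τ) ^ 3) with ht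
  have h2 := (summable_nat_add_iff 1).2 (Real.summable_one_div_nat_pow.2 one_lt_two)
  have h3 := (summable_nat_add_iff 1).2 (Real.summable_one_div_nat_pow.2 (by norm_num : 1 < 3))
  have hts : Summable t := by
    refine (((h3.mul_left (1 / τ ^ 3)).add (h2.mul_left (1 / τ ^ 2))).mul_left
      (100 * ‖z‖ ^ 3)).congr fun j => ?_
    simp only [ht]
    push_cast
    field_simp
  have hO : (fun j => Real.exp (t j) - 1) =O[atTop] t := by
    have := ((Real.hasDerivAt_exp 0).isBigO_sub).comp_tendsto hts.tendsto_atTop_zero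
    simpa [Function.comp_def] using this
  refine summable_of_isBigO_nat hts (Asymptotics.IsBigO.trans ?_ hO)
  have hlarge : ∀ᶠ j : ℕ in atTop, ‖z‖ < (j + 1) * τ :=
    ((tendsto_natCast_atTop_atTop.atTop_add tendsto_const_nhds).atTop_mul_const hτ).eventually
      (eventually_gt_atTop _)
  refine Asymptotics.IsBigO.of_bound 1 (hlarge.mono fun j hj => ?_)
  obtain ⟨_, _, -, -, -, -, h⟩ := exists_digamma_eq (x := (j + 1) * τ) (by positivity)
  rw [norm_norm, one_mul]
  exact (h z hj).trans (Real.le_norm_self _)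

lemma doubleGamma_eq (τ : ℝ) (z : ℂ) :
    doubleGamma τ z = 1 / (τ * Complex.Gamma z) *
      Complex.exp (barnesA τ * z / τ + barnesB τ * z ^ 2 / (2 * τ ^ 2)) *
        ∏' j : ℕ, barnesFactor ((j + 1) * τ) z := by
  simp only [doubleGamma, barnesFactor]
  push_cast
  simp only [add_comm z]

/-! ### Zeros and non-vanishing -/

/-- The zeros `-jτ - k` of the double gamma function. -/
def doubleGammaZeros (τ : ℝ) : Set ℂ :=
  Set.range fun p : ℕ × ℕ => -(p.1 * τ + p.2 : ℂ)

lemma countable_doubleGammaZeros (τ : ℝ) : (doubleGammaZeros τ).Countable :=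
  Set.countable_range _

/-- The zero set is stable under subtraction of `1` and of `τ`. Hence the single condition that `v`
is not a zero also covers `v+1`, `v+τ` and `v+1+τ`. -/
lemma add_one_notMem_doubleGammaZeros {τ : ℝ} {z : ℂ} (h : z ∉ doubleGammaZeros τ) :
    z + 1 ∉ doubleGammaZeros τ := by
  rintro ⟨⟨j, k⟩, hjk⟩
  refine h ⟨⟨j, k + 1⟩, ?_⟩
  simp only at hjk ⊢
  push_cast
  linear_combination hjk

lemma add_mul_notMem_doubleGammaZeros {τ : ℝ} {z : ℂ} (h : z ∉ doubleGammaZeros τ) (n : ℕ) :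
    z + n * τ ∉ doubleGammaZeros τ := by
  rintro ⟨⟨j, k⟩, hjk⟩
  refine h ⟨⟨j + n, k⟩, ?_⟩
  simp only at hjk ⊢
  push_cast
  linear_combination hjk

lemma Gamma_ne_zero_of_notMem {τ : ℝ} {z : ℂ} (h : z ∉ doubleGammaZeros τ) :
    Complex.Gamma z ≠ 0 := by
  refine Complex.Gamma_ne_zero fun m hm => h ⟨⟨0, m⟩, ?_⟩
  simp [hm]

lemma ne_zero_of_notMem {τ : ℝ} {z : ℂ} (h : z ∉ doubleGammaZeros τ) : z ≠ 0 := by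
  rintro rfl
  exact Gamma_ne_zero_of_notMem h Complex.Gamma_zero

lemma barnesFactor_ne_zero {τ : ℝ} (hτ : 0 < τ) {z : ℂ} (h : z ∉ doubleGammaZeros τ) (j : ℕ) :
    barnesFactor ((j + 1) * τ) z ≠ 0 := by
  rw [Ne, barnesFactor_eq_zero_iff (by positivity)]
  have := Gamma_ne_zero_of_notMem (add_mul_notMem_doubleGammaZeros h (j + 1))
  push_cast at this ⊢
  rwa [add_comm]

lemma tprod_barnesFactor_ne_zero {τ : ℝ} (hτ : 0 < τ) {z : ℂ} (h : z ∉ doubleGammaZeros τ) :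
    ∏' j : ℕ, barnesFactor ((j + 1) * τ) z ≠ 0 := by
  have := tprod_one_add_ne_zero_of_summable
    (f := fun j : ℕ => barnesFactor ((j + 1) * τ) z - 1)
    (fun j => by simpa using barnesFactor_ne_zero hτ h j)
    (summable_norm_barnesFactor_sub_one hτ z)
  simpa using this

lemma tendsto_prod_barnesFactor {τ : ℝ} (hτ : 0 < τ) (z : ℂ) :
    Tendsto (fun N : ℕ => ∏ j ∈ Finset.range N, barnesFactor ((j + 1) * τ) z) atTop
      (𝓝 (∏' j : ℕ, barnesFactor ((j + 1) * τ) z)) := by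
  have := (multipliable_one_add_of_summable
    (summable_norm_barnesFactor_sub_one hτ z)).tendsto_prod_tprod_nat
  simpa using this

lemma doubleGamma_ne_zero {τ : ℝ} (hτ : 0 < τ) {z : ℂ} (h : z ∉ doubleGammaZeros τ) :
    doubleGamma τ z ≠ 0 := by
  have : (τ : ℂ) ≠ 0 := by exact_mod_cast hτ.ne'
  rw [doubleGamma_eq]
  exact mul_ne_zero (mul_ne_zero (one_div_ne_zero (mul_ne_zero this (Gamma_ne_zero_of_notMem h)))
    (Complex.exp_ne_zero _)) (tprod_barnesFactor_ne_zero hτ h)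

/-! ### The second difference identity for `G` -/

/-- The exponents linear in the argument cancel, and the quadratic ones leave `τ ψ'`, because `v² +
(v+1+τ)² - (v+1)² - (v+τ)² = 2τ`. The Gamma values reduce by `Γ(w+1) = w Γ(w)` to the ratio of
`v+(j+1)τ` and `v+(j+2)τ`, which telescopes in `j`. -/
lemma barnesFactor_second_difference {τ : ℝ} {v : ℂ}
    (h : v ∉ doubleGammaZeros τ) (j : ℕ) :
    barnesFactor ((j + 1) * τ) v * barnesFactor ((j + 1) * τ) (v + 1 + τ) * (v + (j + 2) * τ) =
      (v + (j + 1) * τ) * Complex.exp (τ * deriv Complex.digamma ((j + 1) * τ)) *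
        (barnesFactor ((j + 1) * τ) (v + 1) * barnesFactor ((j + 1) * τ) (v + τ)) := by
  have h1 := add_mul_notMem_doubleGammaZeros h (j + 1)
  have h2 := add_mul_notMem_doubleGammaZeros h (j + 2)
  have g1 := Complex.Gamma_add_one _ (ne_zero_of_notMem h1)
  have g2 := Complex.Gamma_add_one _ (ne_zero_of_notMem h2)
  have n1 := Gamma_ne_zero_of_notMem h1
  have n2 := Gamma_ne_zero_of_notMem h2
  have z1 := ne_zero_of_notMem h1
  have z2 := ne_zero_of_notMem h2
  push_cast at g1 g2 n1 n2 z1 z2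
  simp only [barnesFactor]
  push_cast
  rw [show ((j : ℂ) + 1) * τ + (v + 1 + τ) = v + (j + 2) * τ + 1 by ring,
    show ((j : ℂ) + 1) * τ + (v + 1) = v + (j + 1) * τ + 1 by ring,
    show ((j : ℂ) + 1) * τ + (v + τ) = v + (j + 2) * τ by ring, add_comm _ v, g1, g2]
  set p := Complex.digamma ((j + 1) * τ)
  set p' := deriv Complex.digamma ((j + 1) * τ)
  have he : Complex.exp (v * p + v ^ 2 / 2 * p') *
      Complex.exp ((v + 1 + τ) * p + (v + 1 + τ) ^ 2 / 2 * p') =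
      Complex.exp (τ * p') * (Complex.exp ((v + 1) * p + (v + 1) ^ 2 / 2 * p') *
        Complex.exp ((v + τ) * p + (v + τ) ^ 2 / 2 * p')) := by
    simp only [← Complex.exp_add]
    ring_nf
  generalize Complex.exp (v * p + v ^ 2 / 2 * p') = e₀ at *
  generalize Complex.exp ((v + 1) * p + (v + 1) ^ 2 / 2 * p') = e₁ at *
  generalize Complex.exp ((v + τ) * p + (v + τ) ^ 2 / 2 * p') = e₂ at *
  generalize Complex.exp ((v + 1 + τ) * p + (v + 1 + τ) ^ 2 / 2 * p') = e₃ at *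
  generalize Complex.exp (τ * p') = e at *
  generalize Complex.Gamma (v + (j + 1) * τ) = g at *
  generalize Complex.Gamma (v + (j + 2) * τ) = g' at *
  generalize v + ((j : ℂ) + 1) * τ = x at *
  generalize v + ((j : ℂ) + 2) * τ = y at *
  field_simp
  linear_combination Complex.Gamma ((j + 1) * τ) ^ 2 * he

lemma prod_barnesFactor_second_difference {τ : ℝ} {v : ℂ}
    (h : v ∉ doubleGammaZeros τ) (N : ℕ) :
    (∏ j ∈ Finset.range N, barnesFactor ((j + 1) * τ) v) *
        (∏ j ∈ Finset.range N, barnesFactor ((j + 1) * τ) (v + 1 + τ)) * (v + (N + 1) * τ) =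
      (v + τ) * Complex.exp (τ * ∑ j ∈ Finset.range N, deriv Complex.digamma ((j + 1) * τ)) *
        ((∏ j ∈ Finset.range N, barnesFactor ((j + 1) * τ) (v + 1)) *
          ∏ j ∈ Finset.range N, barnesFactor ((j + 1) * τ) (v + τ)) := by
  induction N with
  | zero => simp
  | succ N ih =>
    have hz := ne_zero_of_notMem (add_mul_notMem_doubleGammaZeros h (N + 1))
    have hN := barnesFactor_second_difference h N
    simp only [Finset.prod_range_succ, Finset.sum_range_succ, mul_add, Complex.exp_add]
    push_cast at hz ⊢
    refine mul_left_cancel₀ hz ?_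
    linear_combination (barnesFactor ((N + 1) * τ) v * barnesFactor ((N + 1) * τ) (v + 1 + τ) *
      (v + (N + 2) * τ)) * ih + ((v + τ) *
      Complex.exp (τ * ∑ j ∈ Finset.range N, deriv Complex.digamma ((j + 1) * τ)) *
        ((∏ j ∈ Finset.range N, barnesFactor ((j + 1) * τ) (v + 1)) *
          ∏ j ∈ Finset.range N, barnesFactor ((j + 1) * τ) (v + τ))) * hN

lemma tendsto_deriv_digamma_zero {τ : ℝ} (hτ : 0 < τ) :
    Tendsto (fun N : ℕ => deriv Complex.digamma ((N + 1) * τ)) atTop (𝓝 0) := by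
  have hx : Tendsto (fun N : ℕ => ((N : ℝ) + 1) * τ) atTop atTop :=
    (tendsto_natCast_atTop_atTop.atTop_add tendsto_const_nhds).atTop_mul_const hτ
  have h1 : Tendsto (fun x : ℝ => x⁻¹ ^ 2 + x⁻¹) atTop (𝓝 0) := by
    simpa using ((tendsto_inv_atTop_zero (𝕜 := ℝ)).pow 2).add tendsto_inv_atTop_zero
  refine squeeze_zero_norm (fun N => ?_) (h1.comp hx)
  obtain ⟨_, b, -, hb, hb0, hb1, -⟩ := exists_digamma_eq (x := (N + 1) * τ) (by positivity)
  push_cast at hb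
  rw [hb, Complex.norm_real, Real.norm_of_nonneg hb0]
  refine hb1.trans (le_of_eq ?_)
  simp only [Function.comp]
  field_simp

/-- At `z = 1` the factor is `e^{ψ(x) + ψ'(x)/2} / x`. It tends to `1`, being a factor of a
convergent product, and `ψ'(x) → 0`; this takes the place of Stirling's formula. -/
lemma tendsto_exp_digamma_div {τ : ℝ} (hτ : 0 < τ) :
    Tendsto (fun N : ℕ => Complex.exp (Complex.digamma ((N + 1) * τ)) / ((N + 1) * τ)) atTop
      (𝓝 1) := by
  have h1 : Tendsto (fun N : ℕ => barnesFactor ((N + 1) * τ) 1) atTop (𝓝 1) := by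
    have := tendsto_zero_iff_norm_tendsto_zero.2
      (summable_norm_barnesFactor_sub_one hτ 1).tendsto_atTop_zero
    simpa using this.add_const 1
  have h2 : Tendsto (fun N : ℕ => Complex.exp (-(deriv Complex.digamma ((N + 1) * τ) / 2))) atTop
      (𝓝 1) := by
    have := ((Complex.continuous_exp.tendsto _).comp
      ((tendsto_deriv_digamma_zero hτ).div_const 2).neg)
    simpa [Function.comp_def] using this
  have h3 := h1.mul h2
  rw [mul_one] at h3
  refine h3.congr fun N => ?_
  have hx : 0 < ((N : ℝ) + 1) * τ := by positivity
  have hne : ((N : ℂ) + 1) * τ ≠ 0 := by exact_mod_cast hx.ne'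
  have hG : Complex.Gamma ((N + 1) * τ) ≠ 0 := by
    have := Complex.Gamma_ne_zero_of_re_pos (s := (((N : ℝ) + 1) * τ : ℝ)) (by simpa using hx)
    simpa using this
  rw [barnesFactor]
  push_cast
  rw [Complex.Gamma_add_one _ hne, mul_assoc, ← Complex.exp_add, one_mul, one_pow,
    one_div_mul_eq_div, add_assoc, add_neg_cancel, add_zero, div_mul_cancel_right₀ hG,
    ← div_eq_inv_mul]

/-- The limit that defines `D(τ)` exists; it is a limit of second differences of the
logarithm of the canonical product. -/
lemma exp_mul_barnesD {τ : ℝ} (hτ : 0 < τ) {v : ℂ} (h : v ∉ doubleGammaZeros τ) :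
    (v + τ) * Complex.exp (τ * barnesD τ) *
      ((∏' j : ℕ, barnesFactor ((j + 1) * τ) (v + 1)) *
        ∏' j : ℕ, barnesFactor ((j + 1) * τ) (v + τ)) =
    (∏' j : ℕ, barnesFactor ((j + 1) * τ) v) *
        ∏' j : ℕ, barnesFactor ((j + 1) * τ) (v + 1 + τ) := by
  have hτ' : (τ : ℂ) ≠ 0 := by exact_mod_cast hτ.ne'
  have h1 := add_one_notMem_doubleGammaZeros h
  have h2 : v + τ ∉ doubleGammaZeros τ := by
    simpa using add_mul_notMem_doubleGammaZeros h 1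
  have h3 : v + 1 + τ ∉ doubleGammaZeros τ := by
    simpa using add_mul_notMem_doubleGammaZeros h1 1
  set T₀ := ∏' j : ℕ, barnesFactor ((j + 1) * τ) v with hT₀
  set T₁ := ∏' j : ℕ, barnesFactor ((j + 1) * τ) (v + 1) with hT₁
  set T₂ := ∏' j : ℕ, barnesFactor ((j + 1) * τ) (v + τ) with hT₂
  set T₃ := ∏' j : ℕ, barnesFactor ((j + 1) * τ) (v + 1 + τ) with hT₃
  have n0 : T₀ ≠ 0 := tprod_barnesFactor_ne_zero hτ h
  have n1 : T₁ ≠ 0 := tprod_barnesFactor_ne_zero hτ h1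
  have n2 : T₂ ≠ 0 := tprod_barnesFactor_ne_zero hτ h2
  have n3 : T₃ ≠ 0 := tprod_barnesFactor_ne_zero hτ h3
  have nv : v + τ ≠ 0 := ne_zero_of_notMem h2
  set T := T₀ * T₃ / ((v + τ) * (T₁ * T₂)) with hT
  have nT : T ≠ 0 := div_ne_zero (mul_ne_zero n0 n3) (mul_ne_zero nv (mul_ne_zero n1 n2))
  set D : ℕ → ℂ := fun m => ∑ k ∈ Finset.Ico 1 m, deriv Complex.digamma (k * τ) +
    deriv Complex.digamma (m * τ) / 2 - 1 / τ * Complex.digamma (m * τ) with hD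
  have hexp : Tendsto (fun N => Complex.exp (τ * D (N + 1))) atTop (𝓝 T) := by
    have hquot := ((tendsto_prod_barnesFactor hτ v).mul
      (tendsto_prod_barnesFactor hτ (v + 1 + τ))).div
      (((tendsto_prod_barnesFactor hτ (v + 1)).mul
        (tendsto_prod_barnesFactor hτ (v + τ))).const_mul (v + τ))
      (mul_ne_zero nv (mul_ne_zero n1 n2))
    -- Telescoping leaves the denominator `v+(N+1)τ`, while the `ψ` term of `D` gives
    -- `e^{-ψ((N+1)τ)}`. The two are compared through `(N+1)τ`.
    have hlin : Tendsto (fun N : ℕ => 1 + v / ((N + 1) * τ)) atTop (𝓝 1) := by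
      have := (tendsto_one_div_add_atTop_nhds_zero_nat (𝕜 := ℂ)).const_mul (v / τ)
      have := this.const_add 1
      simp only [mul_zero, add_zero] at this
      refine this.congr fun N => ?_
      field_simp
    have hψ := (tendsto_exp_digamma_div hτ).inv₀ one_ne_zero
    have hψ' : Tendsto (fun N : ℕ => Complex.exp (τ * (deriv Complex.digamma ((N + 1) * τ) / 2)))
        atTop (𝓝 1) := by
      have := (Complex.continuous_exp.tendsto _).comp
        (((tendsto_deriv_digamma_zero hτ).div_const 2).const_mul (τ : ℂ))
      simpa [Function.comp_def] using this
    have hall := ((hquot.mul hlin).mul hψ).mul hψ'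
    rw [← hT₀, ← hT₁, ← hT₂, ← hT₃, ← hT, inv_one, mul_one, mul_one, mul_one] at hall
    refine hall.congr fun N => ?_
    have hprod := prod_barnesFactor_second_difference h N
    have hN : ((N : ℂ) + 1) ≠ 0 := by exact_mod_cast N.succ_ne_zero
    have m1 : ∏ j ∈ Finset.range N, barnesFactor ((j + 1) * τ) (v + 1) ≠ 0 :=
      Finset.prod_ne_zero_iff.2 fun j _ => barnesFactor_ne_zero hτ h1 j
    have m2 : ∏ j ∈ Finset.range N, barnesFactor ((j + 1) * τ) (v + τ) ≠ 0 :=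
      Finset.prod_ne_zero_iff.2 fun j _ => barnesFactor_ne_zero hτ h2 j
    have hDN : Complex.exp (τ * D (N + 1)) =
        Complex.exp (τ * ∑ j ∈ Finset.range N, deriv Complex.digamma ((j + 1) * τ)) *
          Complex.exp (τ * (deriv Complex.digamma ((N + 1) * τ) / 2)) /
          Complex.exp (Complex.digamma ((N + 1) * τ)) := by
      rw [← Complex.exp_add, ← Complex.exp_sub, hD]
      simp only [Finset.sum_Ico_eq_sum_range, add_tsub_cancel_right]
      push_cast
      congr 1
      simp only [add_comm (1 : ℂ)]
      field_simp
    rw [hDN, Pi.div_apply]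
    have he := Complex.exp_ne_zero (Complex.digamma ((N + 1) * τ))
    generalize Complex.exp (Complex.digamma ((N + 1) * τ)) = e at *
    generalize Complex.exp (τ * (deriv Complex.digamma ((N + 1) * τ) / 2)) = e' at *
    generalize Complex.exp (τ * ∑ j ∈ Finset.range N, deriv Complex.digamma ((j + 1) * τ)) = E at *
    generalize ∏ j ∈ Finset.range N, barnesFactor ((j + 1) * τ) v = p₀ at *
    generalize ∏ j ∈ Finset.range N, barnesFactor ((j + 1) * τ) (v + 1) = p₁ at *
    generalize ∏ j ∈ Finset.range N, barnesFactor ((j + 1) * τ) (v + τ) = p₂ at *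
    generalize ∏ j ∈ Finset.range N, barnesFactor ((j + 1) * τ) (v + 1 + τ) = p₃ at *
    field_simp
    linear_combination e' * hprod
  -- Convergence of `exp (τ D)` determines `D` only modulo `2πi/τ`. As each `D (N + 1)` is real, it
  -- can be read off from the norm of the exponential.
  have hreal : ∀ N, ∃ d : ℝ, D (N + 1) = d := fun N => by
    have hr : ∀ k : ℕ, k ≠ 0 → ∃ a b : ℝ, Complex.digamma (k * τ) = a ∧
        deriv Complex.digamma (k * τ) = b := fun k hk => by
      obtain ⟨a, b, ha, hb, -⟩ := exists_digamma_eq (x := k * τ) (by positivity)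
      exact ⟨a, b, by simpa using ha, by simpa using hb⟩
    choose! a b ha hb using hr
    refine ⟨∑ k ∈ Finset.Ico 1 (N + 1), b k + b (N + 1) / 2 - 1 / τ * a (N + 1), ?_⟩
    simp only [hD]
    rw [ha _ N.succ_ne_zero, hb _ N.succ_ne_zero, Finset.sum_congr rfl fun k hk =>
      hb k (Nat.one_le_iff_ne_zero.1 (Finset.mem_Ico.1 hk).1)]
    push_cast
    rfl
  choose d hd using hreal
  have hdlim : Tendsto d atTop (𝓝 (Real.log ‖T‖ / τ)) := by
    have := ((hexp.norm).log (norm_ne_zero_iff.2 nT)).div_const τ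
    refine this.congr fun N => ?_
    rw [hd, Complex.norm_exp, Real.log_exp, ← Complex.ofReal_mul, Complex.ofReal_re]
    field_simp
  have hDlim : Tendsto (fun N => D (N + 1)) atTop (𝓝 ((Real.log ‖T‖ / τ : ℝ) : ℂ)) := by
    simp only [hd]
    exact (Complex.continuous_ofReal.tendsto _).comp hdlim
  have hDeq : barnesD τ = ((Real.log ‖T‖ / τ : ℝ) : ℂ) :=
    ((tendsto_add_atTop_iff_nat 1).1 hDlim).limUnder_eq
  have hTD : Complex.exp (τ * barnesD τ) = T := by
    rw [hDeq]
    exact tendsto_nhds_unique ((Complex.continuous_exp.tendsto _).comp (hDlim.const_mul _)) hexp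
  rw [hTD, hT]
  field_simp

/-- The consequence of the functional equations of `G` that compares the shifts by `1` and `τ`. -/
theorem doubleGamma_mul_doubleGamma_add {τ : ℝ} (hτ : 0 < τ) {v : ℂ}
    (h : v ∉ doubleGammaZeros τ) :
    doubleGamma τ v * doubleGamma τ (v + 1 + τ) =
      v / τ * (doubleGamma τ (v + 1) * doubleGamma τ (v + τ)) := by
  have hτ' : (τ : ℂ) ≠ 0 := by exact_mod_cast hτ.ne'
  have h2 : v + τ ∉ doubleGammaZeros τ := by
    simpa using add_mul_notMem_doubleGammaZeros h 1
  have nv := ne_zero_of_notMem h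
  have nv2 := ne_zero_of_notMem h2
  have g0 := Gamma_ne_zero_of_notMem h
  have g2 := Gamma_ne_zero_of_notMem h2
  have hD := exp_mul_barnesD hτ h
  have hlog : Complex.exp (Real.log τ) = τ := by
    rw [← Complex.ofReal_exp, Real.exp_log hτ]
  -- The second difference of the exponent is `b̃/τ = -log τ - τ D(τ)`; the part with `ã` drops out.
  have he : Complex.exp (barnesA τ * v / τ + barnesB τ * v ^ 2 / (2 * τ ^ 2)) *
      Complex.exp (barnesA τ * (v + 1 + τ) / τ + barnesB τ * (v + 1 + τ) ^ 2 / (2 * τ ^ 2)) *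
      (τ * Complex.exp (τ * barnesD τ)) =
      Complex.exp (barnesA τ * (v + 1) / τ + barnesB τ * (v + 1) ^ 2 / (2 * τ ^ 2)) *
      Complex.exp (barnesA τ * (v + τ) / τ + barnesB τ * (v + τ) ^ 2 / (2 * τ ^ 2)) := by
    have : τ * Complex.exp (τ * barnesD τ) = Complex.exp (Real.log τ + τ * barnesD τ) := by
      rw [Complex.exp_add, hlog]
    rw [this, ← Complex.exp_add, ← Complex.exp_add, ← Complex.exp_add]
    congr 1
    simp only [barnesB]
    push_cast
    field_simp
    ring
  simp only [doubleGamma_eq]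
  rw [show v + 1 + (τ : ℂ) = v + τ + 1 by ring] at *
  rw [Complex.Gamma_add_one _ nv, Complex.Gamma_add_one _ nv2]
  generalize ∏' j : ℕ, barnesFactor ((j + 1) * τ) v = p₀ at *
  generalize ∏' j : ℕ, barnesFactor ((j + 1) * τ) (v + 1) = p₁ at *
  generalize ∏' j : ℕ, barnesFactor ((j + 1) * τ) (v + τ) = p₂ at *
  generalize ∏' j : ℕ, barnesFactor ((j + 1) * τ) (v + τ + 1) = p₃ at *
  generalize Complex.exp (barnesA τ * v / τ + barnesB τ * v ^ 2 / (2 * τ ^ 2)) = e₀ at *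
  generalize Complex.exp (barnesA τ * (v + 1) / τ + barnesB τ * (v + 1) ^ 2 / (2 * τ ^ 2)) = e₁ at *
  generalize Complex.exp (barnesA τ * (v + τ) / τ + barnesB τ * (v + τ) ^ 2 / (2 * τ ^ 2)) = e₂ at *
  generalize Complex.exp (barnesA τ * (v + τ + 1) / τ +
    barnesB τ * (v + τ + 1) ^ 2 / (2 * τ ^ 2)) = e₃ at *
  generalize Complex.exp (τ * barnesD τ) = d at *
  field_simp
  linear_combination (-(e₀ * e₃ * τ)) * hD + (v + τ) * p₁ * p₂ * he

/-! ### Differentiation under the integral sign -/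

/-- A linear exponential times a linear function is bounded by the exponentials at the four
corners of a square. -/
lemma norm_mul_norm_exp_le {r : ℝ} (hr : 0 < r) (s w : ℂ) (hw : ‖w‖ ≤ r) :
    ‖s‖ * ‖Complex.exp (-s * w)‖ ≤ 1 / r *
      ((‖Complex.exp (-s * ↑(4 * r))‖ + ‖Complex.exp (-s * -↑(4 * r))‖) +
      (‖Complex.exp (-s * (↑(4 * r) * Complex.I))‖ +
        ‖Complex.exp (-s * -(↑(4 * r) * Complex.I))‖)) := by
  have h1 : ‖Complex.exp (-s * w)‖ ≤ Real.exp (r * ‖s‖) := by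
    refine (Complex.norm_exp_le_exp_norm _).trans (Real.exp_le_exp.2 ?_)
    rw [norm_mul, norm_neg, mul_comm]
    gcongr
  have h2 : ‖s‖ ≤ 1 / r * Real.exp (r * ‖s‖) := by
    rw [one_div, ← div_eq_inv_mul, le_div_iff₀ hr]
    linarith [Real.add_one_le_exp (r * ‖s‖)]
  have h3 : Real.exp (r * ‖s‖) * Real.exp (r * ‖s‖) ≤
      (Real.exp (-(s.re * (4 * r))) + Real.exp (s.re * (4 * r))) +
      (Real.exp (s.im * (4 * r)) + Real.exp (-(s.im * (4 * r)))) := by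
    rw [← Real.exp_add]
    have hs := Complex.norm_le_abs_re_add_abs_im s
    have p1 := Real.exp_pos (-(s.re * (4 * r)))
    have p2 := Real.exp_pos (s.re * (4 * r))
    have p3 := Real.exp_pos (s.im * (4 * r))
    have p4 := Real.exp_pos (-(s.im * (4 * r)))
    have key : ∀ y : ℝ, r * ‖s‖ + r * ‖s‖ ≤ y → Real.exp (r * ‖s‖ + r * ‖s‖) ≤ Real.exp y :=
      fun y hy => Real.exp_le_exp.2 hy
    rcases le_total |s.im| |s.re| with h | h
    · rcases abs_cases s.re with ⟨h', -⟩ | ⟨h', -⟩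
      · linarith [key (s.re * (4 * r)) (by nlinarith)]
      · linarith [key (-(s.re * (4 * r))) (by nlinarith)]
    · rcases abs_cases s.im with ⟨h', -⟩ | ⟨h', -⟩
      · linarith [key (s.im * (4 * r)) (by nlinarith)]
      · linarith [key (-(s.im * (4 * r))) (by nlinarith)]
  have h4 : (‖Complex.exp (-s * ↑(4 * r))‖ + ‖Complex.exp (-s * -↑(4 * r))‖) +
      (‖Complex.exp (-s * (↑(4 * r) * Complex.I))‖ +
        ‖Complex.exp (-s * -(↑(4 * r) * Complex.I))‖) =
      (Real.exp (-(s.re * (4 * r))) + Real.exp (s.re * (4 * r))) +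
      (Real.exp (s.im * (4 * r)) + Real.exp (-(s.im * (4 * r)))) := by
    simp [Complex.norm_exp]
  rw [h4]
  calc ‖s‖ * ‖Complex.exp (-s * w)‖
      ≤ 1 / r * Real.exp (r * ‖s‖) * Real.exp (r * ‖s‖) := by gcongr
    _ = 1 / r * (Real.exp (r * ‖s‖) * Real.exp (r * ‖s‖)) := by ring
    _ ≤ _ := by gcongr

/-- A Laplace-type integral may be differentiated under the integral sign in the interior of its
domain of absolute convergence. -/
lemma hasDerivAt_integral_mul_exp {F g : ℝ → ℂ} (hg : Continuous g) {ζ₀ : ℂ}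
    (h : ∀ᶠ ζ in 𝓝 ζ₀, Integrable fun t => F t * Complex.exp (-g t * ζ)) :
    Integrable (fun t => g t * (F t * Complex.exp (-g t * ζ₀))) ∧
    HasDerivAt (fun ζ => ∫ t, F t * Complex.exp (-g t * ζ))
      (-∫ t, g t * (F t * Complex.exp (-g t * ζ₀))) ζ₀ := by
  obtain ⟨R, hR, hball⟩ := Metric.eventually_nhds_iff_ball.1 h
  -- The four points at distance `4r` from `ζ₀` must lie in the ball of radius `R`, where the
  -- integral converges.
  set r := R / 5 with hr
  have hr0 : 0 < r := by positivity
  have hint : ∀ u : ℂ, ‖u‖ < R → Integrable fun t => F t * Complex.exp (-g t * (ζ₀ + u)) :=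
    fun u hu => hball _ (by simpa [dist_eq_norm] using hu)
  have hn : ‖((4 * r : ℝ) : ℂ)‖ < R := by
    rw [Complex.norm_real, Real.norm_of_nonneg (by positivity)]; linarith
  have i1 := hint _ hn
  have i2 := hint (-((4 * r : ℝ) : ℂ)) (by rwa [norm_neg])
  have i3 := hint (((4 * r : ℝ) : ℂ) * Complex.I) (by simpa using hn)
  have i4 := hint (-(((4 * r : ℝ) : ℂ) * Complex.I)) (by simpa using hn)
  have i0 : Integrable fun t => F t * Complex.exp (-g t * ζ₀) := h.self_of_nhds
  have main := hasDerivAt_integral_of_dominated_loc_of_deriv_le (μ := volume)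
    (F := fun ζ t => F t * Complex.exp (-g t * ζ))
    (F' := fun ζ t => -(g t * (F t * Complex.exp (-g t * ζ)))) (x₀ := ζ₀)
    (Metric.ball_mem_nhds ζ₀ hr0) (h.mono fun ζ hζ => hζ.aestronglyMeasurable) i0
    ((hg.aestronglyMeasurable.mul i0.aestronglyMeasurable).neg)
    (ae_of_all _ fun t ζ hζ => ?_)
    (((i1.norm.add i2.norm).add (i3.norm.add i4.norm)).const_mul (1 / r))
    (ae_of_all _ fun t ζ _ => ?_)
  · refine ⟨by simpa using main.1.neg, ?_⟩
    have := main.2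
    rwa [integral_neg] at this
  · have hw : ‖ζ - ζ₀‖ ≤ r := by
      rw [Metric.mem_ball, dist_eq_norm] at hζ
      exact hζ.le
    have hb := norm_mul_norm_exp_le hr0 (g t) (ζ - ζ₀) hw
    have hsplit : ∀ u : ℂ, ‖F t * Complex.exp (-g t * (ζ₀ + u))‖ =
        ‖F t * Complex.exp (-g t * ζ₀)‖ * ‖Complex.exp (-g t * u)‖ := fun u => by
      rw [← norm_mul, mul_assoc, ← Complex.exp_add, mul_add]
    have hζ' : ζ = ζ₀ + (ζ - ζ₀) := by ring
    simp only [Pi.add_apply, hsplit]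
    rw [norm_neg, norm_mul, hζ', hsplit]
    calc _ = ‖F t * Complex.exp (-g t * ζ₀)‖ *
          (‖g t‖ * ‖Complex.exp (-g t * (ζ - ζ₀))‖) := by ring
      _ ≤ _ := mul_le_mul_of_nonneg_left hb (norm_nonneg _)
      _ = _ := by ring
  · have := (((hasDerivAt_id ζ).const_mul (-g t)).cexp).const_mul (F t)
    refine this.congr_deriv ?_
    simp only [id]
    ring

/-- Differentiation along a ray of a Mellin-type integral over a curve in a vertical strip. -/
lemma hasDerivAt_integral_mul_exp_log {F g : ℝ → ℂ} (hg : Continuous g) {M : ℝ}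
    (hM : ∀ t, |(g t).re| ≤ M) {r σ : ℝ} (hr : 0 < r) (c : ℂ)
    (h0 : Integrable fun t => F t * Complex.exp (-g t * (σ * (Real.log r + c))))
    (h1 : Integrable fun t => g t * (F t * Complex.exp (-g t * (σ * (Real.log r + c))))) :
    HasDerivAt (fun x : ℝ => ∫ t, F t * Complex.exp (-g t * (σ * (Real.log x + c))))
      (-(σ / r) * ∫ t, g t * (F t * Complex.exp (-g t * (σ * (Real.log r + c))))) r := by
  -- Measurability of `F` is recovered by multiplying the integrand by the inverse exponential.
  have hF : AEStronglyMeasurable F := by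
    have := h0.aestronglyMeasurable.mul
      (Complex.continuous_exp.comp (hg.mul continuous_const :
        Continuous fun t => g t * (σ * (Real.log r + c)))).aestronglyMeasurable
    refine this.congr (ae_of_all _ fun t => ?_)
    simp only [Pi.mul_apply, Function.comp]
    rw [mul_assoc, ← Complex.exp_add]
    simp
  have hmeas : ∀ x : ℝ,
      AEStronglyMeasurable fun t => F t * Complex.exp (-g t * (σ * (Real.log x + c))) :=
    fun x => hF.mul (Complex.continuous_exp.comp (hg.neg.mul continuous_const)).aestronglyMeasurable
  have main := hasDerivAt_integral_of_dominated_loc_of_deriv_le (μ := volume)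
    (F := fun (x : ℝ) t => F t * Complex.exp (-g t * (σ * (Real.log x + c))))
    (F' := fun x t => -(σ / x) * (g t * (F t * Complex.exp (-g t * (σ * (Real.log x + c))))))
    (x₀ := r) (Metric.ball_mem_nhds r (half_pos hr)) (Eventually.of_forall hmeas) h0
    (h1.aestronglyMeasurable.const_mul _)
    (ae_of_all _ fun t x hx => ?_)
    (h1.norm.const_mul (|σ| * (2 / r) * Real.exp (M * |σ|)))
    (ae_of_all _ fun t x hx => ?_)
  · have := main.2
    rwa [integral_const_mul] at this
  · rw [Metric.mem_ball, Real.dist_eq, abs_lt] at hx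
    have hx0 : 0 < x := by linarith
    -- On the ball of radius `r/2` the ratio `x/r` lies between `1/2` and `2`, and `log 2 < 1`. As
    -- `|Re g| ≤ M`, a change of `x` costs at most a factor `e^{M|σ|}`.
    have hlog : |Real.log x - Real.log r| ≤ 1 := by
      rw [← Real.log_div hx0.ne' hr.ne', abs_le]
      have hxr : 1 / 2 ≤ x / r := by rw [le_div_iff₀ hr]; linarith
      have hxr' : x / r ≤ 2 := by rw [div_le_iff₀ hr]; linarith
      have l2 := Real.log_two_lt_d9
      constructor
      · have := Real.log_le_log (by norm_num) hxr
        rw [one_div, Real.log_inv] at this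
        linarith
      · have := Real.log_le_log (by positivity) hxr'
        linarith
    have hsplit : F t * Complex.exp (-g t * (σ * (Real.log x + c))) =
        F t * Complex.exp (-g t * (σ * (Real.log r + c))) *
          Complex.exp (-g t * (σ * (Real.log x - Real.log r : ℝ))) := by
      rw [mul_assoc, ← Complex.exp_add]
      push_cast
      ring_nf
    have he : ‖Complex.exp (-g t * (σ * (Real.log x - Real.log r : ℝ)))‖ ≤
        Real.exp (M * |σ|) := by
      rw [← Complex.ofReal_mul, Complex.norm_exp, Complex.re_mul_ofReal, Complex.neg_re]
      refine Real.exp_le_exp.2 ((le_abs_self _).trans ?_)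
      rw [abs_mul, abs_mul, abs_neg]
      have hM0 : 0 ≤ M := (abs_nonneg _).trans (hM t)
      calc |(g t).re| * (|σ| * |Real.log x - Real.log r|) ≤ M * (|σ| * 1) := by
            gcongr
            exact hM t
        _ = _ := by ring
    have hσ : ‖(-(σ / x) : ℂ)‖ ≤ |σ| * (2 / r) := by
      rw [norm_neg, norm_div, Complex.norm_real, Complex.norm_real, Real.norm_eq_abs,
        Real.norm_of_nonneg hx0.le, div_eq_mul_inv]
      gcongr
      rw [inv_le_comm₀ hx0 (by positivity), inv_div]
      linarith
    rw [hsplit, norm_mul, ← mul_assoc (g t), norm_mul _ (Complex.exp (-g t * (σ *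
      (Real.log x - Real.log r : ℝ))))]
    calc _ ≤ |σ| * (2 / r) * (‖g t * (F t * Complex.exp (-g t * (σ * (Real.log r + c))))‖ *
          Real.exp (M * |σ|)) := by gcongr
      _ = _ := by ring
  · rw [Metric.mem_ball, Real.dist_eq, abs_lt] at hx
    have hx0 : x ≠ 0 := by linarith
    have := ((((((Real.hasDerivAt_log hx0).ofReal_comp).add_const c).const_mul
      (σ : ℂ)).const_mul (-g t)).cexp).const_mul (F t)
    refine this.congr_deriv ?_
    push_cast
    ring

/-! ### From a kernel identity to the recurrence -/

lemma hasDerivAt_of_exp_eq {U : Set ℂ} {L : ℂ → ℂ} (hU : IsOpen U) (hL : ContinuousOn L U)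
    (hexp : ∀ w ∈ U, Complex.exp (L w) = w) {z : ℂ} (hz : z ∈ U) : HasDerivAt L z⁻¹ z := by
  have h := Complex.hasDerivAt_exp (L z)
  rw [hexp z hz] at h
  refine HasDerivAt.of_local_left_inverse (hL.continuousAt (hU.mem_nhds hz)) h ?_
    (Filter.mem_of_superset (hU.mem_nhds hz) hexp)
  rw [← hexp z hz]
  exact Complex.exp_ne_zero _

/-- If the kernel of `Q` is an affine function times the kernel of `P` almost everywhere on the
contour, then the recurrence between `I_P` and `I_Q` is differentiation under the integral. -/
theorem foxBarnesEuler_of_kernel_eq {γ : ℝ → ℂ} (hγ : Continuous γ) {τ : ℝ} {ε σ : ℂ}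
    {P Q : FoxBarnesData} {A B c₀ c₁ : ℂ} (hc₁ : c₁ ≠ 0) (h₀ : A + B * c₀ = 0)
    (h₁ : B * c₁ = -σ)
    (hQ : ∀ᵐ t : ℝ, foxBarnesKernel τ Q (γ t) = (c₀ + c₁ * γ t) * foxBarnesKernel τ P (γ t)) :
    FoxBarnesEuler γ τ ε σ P Q A B := by
  set F : ℝ → ℂ := fun t => foxBarnesKernel τ P (γ t) *
    Complex.exp (Real.pi * ε * γ t ^ 2 / τ) * deriv γ t with hF
  have hP : ∀ ζ : ℂ, (fun t => foxBarnesIntegrand τ ε P ζ (γ t) * deriv γ t) =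
      fun t => F t * Complex.exp (-γ t * ζ) := fun ζ => by
    funext t
    simp only [foxBarnesIntegrand, hF]
    ring
  have hQae : ∀ ζ : ℂ, (fun t => foxBarnesIntegrand τ ε Q ζ (γ t) * deriv γ t) =ᵐ[volume]
      fun t => c₀ * (F t * Complex.exp (-γ t * ζ)) + c₁ * (γ t * (F t * Complex.exp (-γ t * ζ))) :=
    fun ζ => by
      filter_upwards [hQ] with t ht
      simp only [foxBarnesIntegrand, hF, ht]
      ring
  have hIP : ∀ ζ : ℂ, foxBarnesI γ τ ε P ζ =
      1 / (2 * Real.pi * Complex.I) * ∫ t, F t * Complex.exp (-γ t * ζ) := fun ζ => by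
    rw [foxBarnesI, hP]
  -- Together `h₀` and `h₁` say that `A + B (c₀ + c₁ s) = -σ s` for every `s`.
  have hIQ : ∀ ζ : ℂ, Integrable (fun t => F t * Complex.exp (-γ t * ζ)) →
      Integrable (fun t => γ t * (F t * Complex.exp (-γ t * ζ))) →
      A * foxBarnesI γ τ ε P ζ + B * foxBarnesI γ τ ε Q ζ = 1 / (2 * Real.pi * Complex.I) *
        (-σ * ∫ t, γ t * (F t * Complex.exp (-γ t * ζ))) := fun ζ i0 i1 => by
    rw [hIP, foxBarnesI, integral_congr_ae (hQae ζ),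
      integral_add (i0.const_mul _) (i1.const_mul _), integral_const_mul, integral_const_mul,
      ← h₁]
    linear_combination (1 / (2 * Real.pi * Complex.I) *
      ∫ t, F t * Complex.exp (-γ t * ζ)) * h₀
  simp only [FoxBarnesEuler, FoxBarnesRecurrence, FoxBarnesRayRecurrence, FoxBarnesConverges, hP]
  refine ⟨fun U L hU hL hexp z hz hconv => ?_, fun ⟨M, hM⟩ hσ r φ hr cP cQ => ?_⟩
  · have hz0 : z ≠ 0 := by
      rw [← hexp z hz]
      exact Complex.exp_ne_zero _
    have i0 := hconv.self_of_nhds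
    obtain ⟨i1, hd⟩ := hasDerivAt_integral_mul_exp hγ hconv
    refine ⟨((i0.const_mul c₀).add (i1.const_mul c₁)).congr (hQae _).symm, ?_⟩
    have hd' : HasDerivAt (fun w => foxBarnesI γ τ ε P (σ * L w))
        (1 / (2 * Real.pi * Complex.I) *
          ((-∫ t, γ t * (F t * Complex.exp (-γ t * (σ * L z)))) * (σ * z⁻¹))) z := by
      simp only [hIP]
      exact (HasDerivAt.comp z hd ((hasDerivAt_of_exp_eq hU hL hexp hz).const_mul σ)).const_mul _
    refine ⟨hd'.differentiableAt, ?_⟩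
    rw [hd'.deriv, hIQ _ i0 i1]
    generalize ∫ t, γ t * (F t * Complex.exp (-γ t * (σ * L z))) = J
    field_simp
  · obtain ⟨s, rfl⟩ : ∃ s : ℝ, σ = s := ⟨σ.re, Complex.ext rfl (by simpa using hσ)⟩
    -- On a ray there is no room for the argument with neighbouring points. Instead `γ` times the
    -- integrand of `P` is solved for from the integrands of `Q` and `P`, using `c₁ ≠ 0`.
    have i1 : Integrable fun t => γ t *
        (F t * Complex.exp (-γ t * (s * (Real.log r + φ * Complex.I)))) := by
      refine ((cQ.sub (cP.const_mul c₀)).const_mul c₁⁻¹).congr ?_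
      filter_upwards [hQae (s * (Real.log r + φ * Complex.I))] with t ht
      simp only [Pi.sub_apply, ht]
      field_simp
      ring
    have hd : HasDerivAt (fun x : ℝ =>
        foxBarnesI γ τ ε P (s * (Real.log x + φ * Complex.I)))
        (1 / (2 * Real.pi * Complex.I) * (-(s / r) *
          ∫ t, γ t * (F t * Complex.exp (-γ t * (s * (Real.log r + φ * Complex.I)))))) r := by
      simp only [hIP]
      exact (hasDerivAt_integral_mul_exp_log hγ hM hr _ cP i1).const_mul _
    refine ⟨hd.differentiableAt, ?_⟩
    have hr' : (r : ℂ) ≠ 0 := by exact_mod_cast hr.ne'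
    rw [hd.deriv, hIQ _ cP i1]
    generalize ∫ t, γ t * (F t * Complex.exp (-γ t * (s * (Real.log r + φ * Complex.I)))) = J
    field_simp

/-- Where `γ' ≠ 0` a given value is taken only at isolated parameters, so each fibre is null. The
contour may pass through zeros of factors that are cancelled in the kernel identity, where division
by zero has a default value; the integrals do not see these points. -/
lemma ae_notMem_of_countable {γ : ℝ → ℂ}
    (hγ : ∃ S : Finset ℝ, ∀ t ∉ S, ContDiffAt ℝ 1 γ t ∧ deriv γ t ≠ 0) {Z : Set ℂ}
    (hZ : Z.Countable) : ∀ᵐ t : ℝ, γ t ∉ Z := by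
  obtain ⟨S, hS⟩ := hγ
  have hfin : ∀ᵐ t : ℝ, t ∉ (S : Set ℝ) := (S.countable_toSet).ae_notMem volume
  have hpt : ∀ c ∈ Z, ∀ᵐ t : ℝ, t ∉ (S : Set ℝ) → γ t ≠ c := fun c _ => by
    rw [ae_iff]
    refine measure_null_of_locally_null _ fun t ht => ?_
    simp only [ne_eq, Classical.not_imp, not_not, Set.mem_ofPred_eq] at ht
    have hne := ((hS t ht.1).1.differentiableAt one_ne_zero).hasDerivAt.eventually_ne
      (c := c) (hS t ht.1).2
    refine ⟨{t}, ?_, Real.volume_singleton⟩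
    rw [eventually_nhdsWithin_iff] at hne
    refine mem_nhdsWithin_iff_eventually.2 (hne.mono fun x hx hxs => ?_)
    simp only [ne_eq, Classical.not_imp, not_not, Set.mem_ofPred_eq] at hxs
    by_contra hxt
    exact hx hxt hxs.2
  filter_upwards [(ae_ball_iff hZ).2 hpt, hfin] with t ht hts htZ
  exact ht _ htZ hts rfl

lemma ae_affine_notMem_doubleGammaZeros {γ : ℝ → ℂ}
    (hγ : ∃ S : Finset ℝ, ∀ t ∉ S, ContDiffAt ℝ 1 γ t ∧ deriv γ t ≠ 0) (τ : ℝ) (c : ℂ)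
    {d : ℂ} (hd : d ≠ 0) : ∀ᵐ t : ℝ, c + d * γ t ∉ doubleGammaZeros τ :=
  ae_notMem_of_countable hγ <| (countable_doubleGammaZeros τ).preimage
    (f := fun s : ℂ => c + d * s) fun _ _ hxy => mul_left_cancel₀ hd (add_left_cancel hxy)

/-- The recurrence holds if the kernel of `Q` is `v / τ` times the kernel of `P` wherever the
affine function `v` avoids the zeros of the double gamma function. -/
lemma foxBarnesEuler_of_kernel_eq_of_notMem {γ : ℝ → ℂ} {τ : ℝ} (hτ : 0 < τ) {R : FoxBarnesData}
    (hγ : IsFoxBarnesContour γ τ R) {ε σ : ℂ} {P Q : FoxBarnesData} {A B c d : ℂ} (hd : d ≠ 0)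
    (hA : A = σ / d * c) (hB : B = -(σ * τ / d))
    (hQ : ∀ s, c + d * s ∉ doubleGammaZeros τ →
      foxBarnesKernel τ Q s = (c + d * s) / τ * foxBarnesKernel τ P s) :
    FoxBarnesEuler γ τ ε σ P Q A B := by
  have hτ' : (τ : ℂ) ≠ 0 := by exact_mod_cast hτ.ne'
  refine foxBarnesEuler_of_kernel_eq hγ.continuous (c₀ := c / τ) (c₁ := d / τ)
    (div_ne_zero hd hτ') ?_ ?_ ?_
  · rw [hA, hB]
    field_simp
    simp
  · rw [hB]
    field_simp
  · filter_upwards [ae_affine_notMem_doubleGammaZeros hγ.piecewise τ c hd] with t ht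
    rw [hQ _ ht]
    ring

/-! ### The relation for `G` inside the kernel -/

lemma mul_div_mul_eq_of_mul_eq {N D g₀ g₁ g₂ g₃ r : ℂ} (h : g₀ * g₃ = r * (g₁ * g₂)) (h₁ : g₁ ≠ 0) :
    N * (g₀ * g₃) / (D * g₁) = r * (N * g₂ / D) := by
  rw [h, show N * (r * (g₁ * g₂)) = r * (N * g₂) * g₁ by ring, mul_div_mul_right _ _ h₁,
    mul_div_assoc]

lemma mul_div_mul_mul_eq_of_mul_eq {N D g₀ g₁ g₂ g₃ r : ℂ} (h : g₀ * g₃ = r * (g₁ * g₂))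
    (h₁ : g₁ ≠ 0) (h₂ : g₂ ≠ 0) (h₃ : g₃ ≠ 0) :
    N * g₀ / (D * (g₁ * g₂)) = r * (N / (D * g₃)) := by
  rw [← mul_div_mul_right _ _ h₃, mul_assoc, h,
    show N * (r * (g₁ * g₂)) = r * N * (g₁ * g₂) by ring,
    show D * (g₁ * g₂) * g₃ = D * g₃ * (g₁ * g₂) by ring,
    mul_div_mul_right _ _ (mul_ne_zero h₁ h₂), mul_div_assoc]

/-- The second difference identity of the double gamma function, away from its zeros. -/
lemma doubleGamma_second_difference {τ : ℝ} (hτ : 0 < τ) {v : ℂ} (h : v ∉ doubleGammaZeros τ) :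
    doubleGamma τ v * doubleGamma τ (v + 1 + τ) =
        v / τ * (doubleGamma τ (v + 1) * doubleGamma τ (v + τ)) ∧
      doubleGamma τ (v + 1) ≠ 0 ∧ doubleGamma τ (v + τ) ≠ 0 ∧ doubleGamma τ (v + 1 + τ) ≠ 0 := by
  have h₁ := add_one_notMem_doubleGammaZeros h
  have h₂ := add_mul_notMem_doubleGammaZeros h 1
  have h₃ := add_mul_notMem_doubleGammaZeros h₁ 1
  rw [Nat.cast_one, one_mul] at h₂ h₃
  exact ⟨doubleGamma_mul_doubleGamma_add hτ h, doubleGamma_ne_zero hτ h₁,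
    doubleGamma_ne_zero hτ h₂, doubleGamma_ne_zero hτ h₃⟩

section Kernel

variable {τ α : ℝ} {m n : ℕ} {a b : List (ℂ × ℝ)} {x₀ x₁ x₂ x₃ r s : ℂ}

/-- The parameters `x₀` and `x₃` give the arguments `v` and `v+1+τ`, and `x₁`, `x₂` give `v+1` and
`v+τ` in either order. The factor of `P` is that of `x₂`, in the numerator, so only the factor of
`x₁` is divided by and has to be non-zero. -/
lemma foxBarnesKernel_upper_first (hm : m ≤ b.length)
    (h : doubleGamma τ (1 + τ - x₀ - α * s) * doubleGamma τ (1 + τ - x₃ - α * s) =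
      r * (doubleGamma τ (1 + τ - x₁ - α * s) * doubleGamma τ (1 + τ - x₂ - α * s)))
    (h₁ : doubleGamma τ (1 + τ - x₁ - α * s) ≠ 0) :
    foxBarnesKernel τ ⟨m, n + 2, (x₀, α) :: (x₃, α) :: a, b ++ [(x₁, α)]⟩ s =
      r * foxBarnesKernel τ ⟨m, n + 1, (x₂, α) :: a, b⟩ s := by
  simp only [foxBarnesKernel, List.take_append_of_le_length hm, List.drop_append_of_le_length hm,
    List.take_succ_cons, List.drop_succ_cons, List.map_cons, List.prod_cons, List.map_append,
    List.prod_append, List.map_nil, List.prod_nil, mul_one]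
  rw [mul_right_comm _ (doubleGamma τ (1 + τ - x₁ - α * s)), ← mul_assoc (doubleGamma τ _)
    (doubleGamma τ _), mul_left_comm _ (_ * _), mul_comm (_ * _) (_ * List.prod _),
    mul_div_mul_eq_of_mul_eq h h₁]
  congr 2
  ring

lemma foxBarnesKernel_lower_first (hn : n ≤ a.length)
    (h : doubleGamma τ (x₀ + α * s) * doubleGamma τ (x₃ + α * s) =
      r * (doubleGamma τ (x₁ + α * s) * doubleGamma τ (x₂ + α * s)))
    (h₁ : doubleGamma τ (x₁ + α * s) ≠ 0) :
    foxBarnesKernel τ ⟨m + 2, n, a ++ [(x₁, α)], (x₀, α) :: (x₃, α) :: b⟩ s =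
      r * foxBarnesKernel τ ⟨m + 1, n, a, (x₂, α) :: b⟩ s := by
  simp only [foxBarnesKernel, List.take_append_of_le_length hn, List.drop_append_of_le_length hn,
    List.take_succ_cons, List.drop_succ_cons, List.map_cons, List.prod_cons, List.map_append,
    List.prod_append, List.map_nil, List.prod_nil, mul_one]
  rw [← mul_assoc _ _ (doubleGamma τ (x₁ + α * s)), ← mul_assoc (doubleGamma τ _)
    (doubleGamma τ _), mul_assoc (_ * _), mul_comm (_ * _) (_ * List.prod _),
    mul_div_mul_eq_of_mul_eq h h₁]
  congr 2
  ring

/-- Here the factor of `P` is that of `x₃`, in the denominator, and the factors of `x₁` and `x₂` are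
in the denominator of `Q`, so all three must be non-zero. -/
lemma foxBarnesKernel_lower_last (hm : m ≤ b.length)
    (h : doubleGamma τ (1 + τ - x₀ - α * s) * doubleGamma τ (1 + τ - x₃ - α * s) =
      r * (doubleGamma τ (1 + τ - x₁ - α * s) * doubleGamma τ (1 + τ - x₂ - α * s)))
    (h₁ : doubleGamma τ (1 + τ - x₁ - α * s) ≠ 0) (h₂ : doubleGamma τ (1 + τ - x₂ - α * s) ≠ 0)
    (h₃ : doubleGamma τ (1 + τ - x₃ - α * s) ≠ 0) :
    foxBarnesKernel τ ⟨m, n + 1, (x₀, α) :: a, b ++ [(x₁, α), (x₂, α)]⟩ s =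
      r * foxBarnesKernel τ ⟨m, n, a, b ++ [(x₃, α)]⟩ s := by
  simp only [foxBarnesKernel, List.take_append_of_le_length hm, List.drop_append_of_le_length hm,
    List.take_succ_cons, List.drop_succ_cons, List.map_cons, List.prod_cons, List.map_append,
    List.prod_append, List.map_nil, List.prod_nil, mul_one]
  rw [mul_comm (doubleGamma τ _) (List.prod _), ← mul_assoc (List.prod _) (List.prod _)
    (doubleGamma τ _), mul_right_comm (List.prod _) (_ * _) (List.prod _),
    mul_div_mul_mul_eq_of_mul_eq h h₁ h₂ h₃,
    mul_right_comm (List.prod _) (doubleGamma τ _) (List.prod _)]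

lemma foxBarnesKernel_upper_last (hn : n ≤ a.length)
    (h : doubleGamma τ (x₀ + α * s) * doubleGamma τ (x₃ + α * s) =
      r * (doubleGamma τ (x₁ + α * s) * doubleGamma τ (x₂ + α * s)))
    (h₁ : doubleGamma τ (x₁ + α * s) ≠ 0) (h₂ : doubleGamma τ (x₂ + α * s) ≠ 0)
    (h₃ : doubleGamma τ (x₃ + α * s) ≠ 0) :
    foxBarnesKernel τ ⟨m + 1, n, a ++ [(x₁, α), (x₂, α)], (x₀, α) :: b⟩ s =
      r * foxBarnesKernel τ ⟨m, n, a ++ [(x₃, α)], b⟩ s := by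
  simp only [foxBarnesKernel, List.take_append_of_le_length hn, List.drop_append_of_le_length hn,
    List.take_succ_cons, List.drop_succ_cons, List.map_cons, List.prod_cons, List.map_append,
    List.prod_append, List.map_nil, List.prod_nil, mul_one]
  rw [mul_assoc (doubleGamma τ _), mul_comm (doubleGamma τ _), ← mul_assoc (List.prod _)
    (List.prod _) (_ * _), mul_div_mul_mul_eq_of_mul_eq h h₁ h₂ h₃, mul_assoc (List.prod _)
    (List.prod _) (doubleGamma τ _)]

end Kernel

/-! ### The six recurrences -/

theorem mainTheorem9 (τ : ℝ) (hτ : 0 < τ) (ε σ : ℂ) (m n : ℕ) (a b : List (ℂ × ℝ))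
    (hP : FoxBarnesData.Admissible ⟨m, n, a, b⟩)
    (γ : ℝ → ℂ) (hγ : IsFoxBarnesContour γ τ ⟨m, n, a, b⟩) :
    (∀ (a₁ : ℂ) (α₁ : ℝ) (a' : List (ℂ × ℝ)), a = (a₁, α₁) :: a' → 1 ≤ n →
      FoxBarnesEuler γ τ ε σ ⟨m, n, a, b⟩
          ⟨m, n + 1, (a₁ + τ, α₁) :: (a₁ - 1, α₁) :: a', b ++ [(a₁ + τ - 1, α₁)]⟩
          (σ / α₁ * (a₁ - 1)) (σ * τ / α₁) ∧
      FoxBarnesEuler γ τ ε σ ⟨m, n, a, b⟩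
          ⟨m, n + 1, (a₁ + 1, α₁) :: (a₁ - τ, α₁) :: a', b ++ [(a₁ + 1 - τ, α₁)]⟩
          (σ / α₁ * (a₁ - τ)) (σ * τ / α₁)) ∧
    (∀ (b₁ : ℂ) (β₁ : ℝ) (b' : List (ℂ × ℝ)), b = (b₁, β₁) :: b' → 1 ≤ m →
      FoxBarnesEuler γ τ ε σ ⟨m, n, a, b⟩
          ⟨m + 1, n, a ++ [(b₁ + τ - 1, β₁)], (b₁ - 1, β₁) :: (b₁ + τ, β₁) :: b'⟩
          (σ / β₁ * (b₁ - 1)) (-(σ * τ / β₁)) ∧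
      FoxBarnesEuler γ τ ε σ ⟨m, n, a, b⟩
          ⟨m + 1, n, a ++ [(b₁ + 1 - τ, β₁)], (b₁ - τ, β₁) :: (b₁ + 1, β₁) :: b'⟩
          (σ / β₁ * (b₁ - τ)) (-(σ * τ / β₁))) ∧
    (∀ (bq : ℂ) (βq : ℝ) (b' : List (ℂ × ℝ)), b = b' ++ [(bq, βq)] → m + 1 ≤ b.length →
      FoxBarnesEuler γ τ ε σ ⟨m, n, a, b⟩
          ⟨m, n + 1, (1 + τ + bq, βq) :: a, b' ++ [(bq + τ, βq), (bq + 1, βq)]⟩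
          (σ / βq * bq) (σ * τ / βq)) ∧
    (∀ (ap : ℂ) (αp : ℝ) (a' : List (ℂ × ℝ)), a = a' ++ [(ap, αp)] → n + 1 ≤ a.length →
      FoxBarnesEuler γ τ ε σ ⟨m, n, a, b⟩
          ⟨m + 1, n, a' ++ [(ap - τ, αp), (ap - 1, αp)], (ap - 1 - τ, αp) :: b⟩
          (σ / αp * (ap - 1 - τ)) (-(σ * τ / αp))) := by
  have hα : ∀ x ∈ a, (x.2 : ℂ) ≠ 0 := fun x hx => by exact_mod_cast (hP.α_pos x hx).ne'
  have hβ : ∀ x ∈ b, (x.2 : ℂ) ≠ 0 := fun x hx => by exact_mod_cast (hP.β_pos x hx).ne'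
  have hm : m ≤ b.length := hP.m_le
  have hn : n ≤ a.length := hP.n_le
  refine ⟨?_, ?_, ?_, ?_⟩
  · rintro a₁ α₁ a' rfl hn1
    obtain ⟨n, rfl⟩ := Nat.exists_eq_add_of_le' hn1
    have hne : (α₁ : ℂ) ≠ 0 := hα _ List.mem_cons_self
    constructor
    -- With `v = 1 - a₁ - α₁ s` the factor of `a₁` is `G(v+τ)`.
    · refine foxBarnesEuler_of_kernel_eq_of_notMem hτ hγ (c := 1 - a₁) (d := -α₁)
        (neg_ne_zero.2 hne) (by field_simp; ring) (by field_simp) fun s hs => ?_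
      obtain ⟨hv, h₁, h₂, h₃⟩ := doubleGamma_second_difference hτ hs
      refine foxBarnesKernel_upper_first hm ?_ ?_
      · convert hv using 3 <;> ring_nf
      · convert h₁ using 2; ring
    -- Now the factor of `a₁` is `G(v+1)`: the roles of `1` and `τ` are exchanged, hence the swap of
    -- the two middle factors.
    · refine foxBarnesEuler_of_kernel_eq_of_notMem hτ hγ (c := τ - a₁) (d := -α₁)
        (neg_ne_zero.2 hne) (by field_simp; ring) (by field_simp) fun s hs => ?_
      obtain ⟨hv, h₁, h₂, h₃⟩ := doubleGamma_second_difference hτ hs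
      rw [mul_comm (doubleGamma τ (_ + 1))] at hv
      refine foxBarnesKernel_upper_first hm ?_ ?_
      · convert hv using 3 <;> ring_nf
      · convert h₂ using 2; ring
  · rintro b₁ β₁ b' rfl hm1
    obtain ⟨m, rfl⟩ := Nat.exists_eq_add_of_le' hm1
    have hne : (β₁ : ℂ) ≠ 0 := hβ _ List.mem_cons_self
    constructor
    · refine foxBarnesEuler_of_kernel_eq_of_notMem hτ hγ (c := b₁ - 1) (d := β₁)
        hne rfl rfl fun s hs => ?_
      obtain ⟨hv, h₁, h₂, h₃⟩ := doubleGamma_second_difference hτ hs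
      rw [mul_comm (doubleGamma τ (_ + 1))] at hv
      refine foxBarnesKernel_lower_first hn ?_ ?_
      · convert hv using 3 <;> ring_nf
      · convert h₂ using 2; ring
    · refine foxBarnesEuler_of_kernel_eq_of_notMem hτ hγ (c := b₁ - τ) (d := β₁)
        hne rfl rfl fun s hs => ?_
      obtain ⟨hv, h₁, h₂, h₃⟩ := doubleGamma_second_difference hτ hs
      refine foxBarnesKernel_lower_first hn ?_ ?_
      · convert hv using 3 <;> ring_nf
      · convert h₁ using 2; ring
  · rintro bq βq b' rfl hm1
    have hne : (βq : ℂ) ≠ 0 := hβ (bq, βq) (by simp)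
    -- The factor of the last lower parameter is `G(v+1+τ)` in the denominator.
    refine foxBarnesEuler_of_kernel_eq_of_notMem hτ hγ (c := -bq) (d := -βq)
      (neg_ne_zero.2 hne) (by field_simp) (by field_simp) fun s hs => ?_
    obtain ⟨hv, h₁, h₂, h₃⟩ := doubleGamma_second_difference hτ hs
    refine foxBarnesKernel_lower_last (by simpa using hm1) ?_ ?_ ?_ ?_
    · convert hv using 3 <;> ring_nf
    · convert h₁ using 2; ring
    · convert h₂ using 2; ring
    · convert h₃ using 2; ring
  · rintro ap αp a' rfl hn1
    have hne : (αp : ℂ) ≠ 0 := hα (ap, αp) (by simp)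
    refine foxBarnesEuler_of_kernel_eq_of_notMem hτ hγ (c := ap - 1 - τ) (d := αp)
      hne rfl rfl fun s hs => ?_
    obtain ⟨hv, h₁, h₂, h₃⟩ := doubleGamma_second_difference hτ hs
    refine foxBarnesKernel_upper_last (by simpa using hn1) ?_ ?_ ?_ ?_
    · convert hv using 3 <;> ring_nf
    · convert h₁ using 2; ring
    · convert h₂ using 2; ring
    · convert h₃ using 2; ring
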